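/- All matrices have $\mathbb Z_2$ coefficients. A filtered simplicial complex of size $n$ is a sequence of finite simplicial complexes $\emptyset=\mathsf K_0\subset\mathsf K_1\subset\cdots\subset\mathsf K_n$ with $\mathsf K_i\setminus\mathsf K_{i-1}=\{\sigma_i\}$ for all $i$ (simplices are nonempty). Its boundary matrix is the $n\times n$ matrix $D$ with $D^i_j=1$ if $\sigma_i$ is a facet of $\sigma_j$ and $D^i_j=0$ otherwise. The pivot of a nonzero column is the largest row index of a nonzero entry. The following algorithms transform a matrix $R$, initially $R=D$. - *Twist reduction*: process the columns $j$ by decreasing dimension of $\sigma_j$, and from left to right within each dimension. While some column $R_{j'}$ with $j'<j$ has the same pivot as the nonzero column $R_j$, add $R_{j'}$ to $R_j$. Afterwards, if $R_j\ne 0$ has pivot $i$, set $R_i$ to $0$. - *Swap reduction*: the same, except that before each addition of $R_{j'}$ to $R_j$ the two columns are exchanged if $R_j$ has fewer nonzero entries than $R_{j'}$. - *Retrospective reduction*: maintain a partial pairing $P$, initially empty. For $j=1,\dots,n$: remove from $R_j$ all entries in rows $i$ with $i=P[\ell]$ for some $\ell$, and then call $\mathrm{Reduce}(j)$. Here $\mathrm{Reduce}(j)$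 is the following recursive procedure: while $R_j$ has a nonzero entry in a row $\ell$ for which $P[\ell]$ is defined and different from $j$, take the largest such $\ell$, call $\mathrm{Reduce}(P[\ell])$ and then add column $R_{P[\ell]}$ to $R_j$; finally, if $R_j\neq0$ has pivot $i$, set $P[i]=j$. The number of bitflips of a run is the sum, over all column additions performed, of the number of nonzero entries of the column that is added (at the moment of the addition). **Proposition.** Let $A\in\{\text{twist},\text{swap},\text{retrospective}\}$. There exists an infinite family of filtered simplicial complexes with strictly increasing sizes $n$ on which all three algorithms terminate, such that the number of bitflips of $A$ is $O(n)$, while the number of bitflips of each of the other two algorithms is $\Omega(n^2)$. -/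

import Mathlib

/-- A simplexwise filtered simplicial complex with vertices in `V`: nested complexes
`∅ = K₀ ⊆ K₁ ⊆ ⋯ ⊆ K_N` such that `K_{i+1}` arises from `K_i` by adding one new simplex.
The size is the number `N` of simplices; simplices are indexed from `0` to `N - 1`. -/
structure FilteredComplex (V : Type*) where
  size : ℕ
  complex : Fin (size + 1) → PreAbstractSimplicialComplex V
  simplex : Fin size → Finset V
  complex_zero : complex 0 = ⊥
  simplex_notMem : ∀ i, simplex i ∉ (complex i.castSucc).faces
  complex_succ : ∀ i, (complex i.succ).faces = insert (simplex i) (complex i.castSucc).faces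

namespace FilteredComplex

variable {V : Type*} (K : FilteredComplex V)

/-- The dimension of the `i`-th simplex. -/
def dim (i : Fin K.size) : ℕ := (K.simplex i).card - 1

/-- The dimension of the complex. -/
def maxDim : ℕ := Finset.univ.sup K.dim

/-- The boundary matrix over `ℤ₂`: the entry `(i, j)` is `1` iff the `i`-th simplex is a facet of
the `j`-th one. -/
def boundaryMatrix [DecidableEq V] : Matrix (Fin K.size) (Fin K.size) (ZMod 2) :=
  Matrix.of fun i j =>
    if K.simplex i ⊆ K.simplex j ∧ (K.simplex j).card = (K.simplex i).card + 1 then 1 else 0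

/-- All column indices by decreasing dimension of the simplex, and from left to right within
one dimension. -/
def decreasingDimOrder : List (Fin K.size) :=
  (List.range (K.maxDim + 1)).reverse.flatMap fun d =>
    (List.finRange K.size).filter fun j => K.dim j = d

end FilteredComplex

namespace MatrixReduction

variable {N : ℕ}

/-- The row indices of the nonzero entries of column `j`. -/
def support (R : Matrix (Fin N) (Fin N) (ZMod 2)) (j : Fin N) : Finset (Fin N) :=
  Finset.univ.filter fun i => R i j ≠ 0

/-- The number of nonzero entries of column `j`. -/
def colSize (R : Matrix (Fin N) (Fin N) (ZMod 2)) (j : Fin N) : ℕ := (support R j).card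

/-- The pivot of column `j`: the largest row index of a nonzero entry, `⊥` for a zero column. -/
def pivot (R : Matrix (Fin N) (Fin N) (ZMod 2)) (j : Fin N) : WithBot (Fin N) :=
  (support R j).max

/-- The matrix obtained by adding column `k` to column `j`. -/
def addColumn (R : Matrix (Fin N) (Fin N) (ZMod 2)) (k j : Fin N) :
    Matrix (Fin N) (Fin N) (ZMod 2) :=
  R.updateCol j fun i => R i j + R i k

/-- The matrix obtained by exchanging columns `k` and `j`. -/
def swapColumns (R : Matrix (Fin N) (Fin N) (ZMod 2)) (k j : Fin N) :
    Matrix (Fin N) (Fin N) (ZMod 2) :=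
  R.submatrix id (Equiv.swap k j)

/-- Execution of the loop `for a in l do body a`, for a body given as a relation between the
states before and after its execution. -/
def ForLoop {α S : Type*} (body : α → S → S → Prop) : List α → S → S → Prop
  | [], s, t => s = t
  | a :: l, s, t => ∃ u, body a s u ∧ ForLoop body l u t

/-! ### Twist and swap reduction -/

/-- A state of the twist or swap reduction: the current matrix and the number of bitflips
accumulated so far. -/
structure State (N : ℕ) where
  R : Matrix (Fin N) (Fin N) (ZMod 2)
  flips : ℕ

/-- Columns `k` and `j` are nonzero and have the same pivot. -/
def SamePivot (R : Matrix (Fin N) (Fin N) (ZMod 2)) (k j : Fin N) : Prop :=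
  pivot R k = pivot R j ∧ pivot R j ≠ ⊥

/-- The optional swap: if `swaps` is true and column `j` has fewer entries than column `k`,
exchange the two columns. -/
def trySwap (swaps : Bool) (R : Matrix (Fin N) (Fin N) (ZMod 2)) (k j : Fin N) :
    Matrix (Fin N) (Fin N) (ZMod 2) :=
  if swaps = true ∧ colSize R j < colSize R k then swapColumns R k j else R

/-- One pass of the inner loop: the optional swap, then column `k` is added to column `j`, which
costs as many bitflips as the added column has nonzero entries. -/
def State.step (swaps : Bool) (s : State N) (k j : Fin N) : State N where
  R := addColumn (trySwap swaps s.R k j) k j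
  flips := s.flips + colSize (trySwap swaps s.R k j) k

/-- The inner loop for column `j`: as long as some column `k < j` has the same pivot as column `j`,
it is added to column `j` (after the optional swap). During the reduction there is never more than
one such `k`; taking the smallest one makes the relation visibly deterministic. -/
inductive ReduceColumn (swaps : Bool) (j : Fin N) : State N → State N → Prop
  | done (s : State N) (h : ∀ k < j, ¬ SamePivot s.R k j) : ReduceColumn swaps j s s
  | step (s t : State N) (k : Fin N) (hkj : k < j) (hk : SamePivot s.R k j)
      (hmin : ∀ k' < k, ¬ SamePivot s.R k' j)
      (h : ReduceColumn swaps j (s.step swaps k j) t) : ReduceColumn swaps j s t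

/-- Clearing: if column `j` is nonzero with pivot `i`, column `i` is set to zero. -/
def State.clear (s : State N) (j : Fin N) : State N where
  R := Matrix.of fun a i => if pivot s.R j = (i : WithBot (Fin N)) then 0 else s.R a i
  flips := s.flips

/-- The body of the outer loop: reduce column `j`, then clear. -/
def ProcessColumn (swaps : Bool) (j : Fin N) (s t : State N) : Prop :=
  ∃ u, ReduceColumn swaps j s u ∧ t = u.clear j

/-- The reduction with clearing, by decreasing dimension, terminates on `K` and uses exactly `b`
bitflips. This is the twist reduction for `swaps = false`, the swap reduction for
`swaps = true`. -/
def ClearingRun {V : Type*} [DecidableEq V] (swaps : Bool) (K : FilteredComplex V) (b : ℕ) :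
    Prop :=
  ∃ t : State K.size,
    ForLoop (ProcessColumn swaps) K.decreasingDimOrder ⟨K.boundaryMatrix, 0⟩ t ∧ t.flips = b

/-! ### Retrospective reduction -/

/-- A state of the retrospective reduction: the current matrix, the current pairing (`P i = some j`
if the pivot pair `(i, j)` has been found) and the number of bitflips so far. -/
structure RetroState (N : ℕ) where
  R : Matrix (Fin N) (Fin N) (ZMod 2)
  P : Fin N → Option (Fin N)
  flips : ℕ

/-- Remove from column `j` all negative entries, i.e. all rows `i` that are the second entry of a
pivot pair. (Row indices of column `j` are smaller than `j`, so the pairs that involve them as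
second entry are known when column `j` is processed.) -/
noncomputable def RetroState.compress (s : RetroState N) (j : Fin N) : RetroState N :=
  open Classical in
  { s with R := s.R.updateCol j fun i => if ∃ l, s.P l = some i then 0 else s.R i j }

/-- Column `k` is added to column `j`. -/
def RetroState.add (s : RetroState N) (k j : Fin N) : RetroState N where
  R := addColumn s.R k j
  P := s.P
  flips := s.flips + colSize s.R k

/-- If column `j` is nonzero with pivot `i`, record the pivot pair `(i, j)`. -/
def RetroState.record (s : RetroState N) (j : Fin N) : RetroState N where
  R := s.R
  P := fun i => if pivot s.R j = (i : WithBot (Fin N)) then some j else s.P i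
  flips := s.flips

/-- Entry `l` of column `j` is nonzero and its row is paired with column `k ≠ j`. (The pivot of an
already pivoted column is paired with the column itself and is not to be removed.) -/
def RetroState.PairedEntry (s : RetroState N) (j l k : Fin N) : Prop :=
  s.R l j ≠ 0 ∧ s.P l = some k ∧ k ≠ j

/-- The recursive procedure `Reduce(j)`: as long as column `j` has a paired entry, take the
largest paired entry `l`, call `Reduce(k)` for the column `k` paired with `l`, and add the resulting
column `k` to column `j`; finally record the pivot of column `j`. -/
inductive Reduce : Fin N → RetroState N → RetroState N → Prop
  | done (j : Fin N) (s : RetroState N) (h : ∀ l k, ¬ s.PairedEntry j l k) :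
      Reduce j s (s.record j)
  | step (j l k : Fin N) (s u t : RetroState N) (hl : s.PairedEntry j l k)
      (hmax : ∀ l' k', s.PairedEntry j l' k' → l' ≤ l)
      (hrec : Reduce k s u) (h : Reduce j (u.add k j) t) : Reduce j s t

/-- The retrospective reduction terminates on `K` and uses exactly `b` bitflips. -/
def RetroRun {V : Type*} [DecidableEq V] (K : FilteredComplex V) (b : ℕ) : Prop :=
  ∃ t : RetroState K.size,
    ForLoop (fun j s t => Reduce j (s.compress j) t) (List.finRange K.size)
      ⟨K.boundaryMatrix, fun _ => none, 0⟩ t ∧ t.flips = b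

/-! ### The three algorithms -/

inductive Algorithm
  | twist
  | swap
  | retrospective

/-- `Bitflips A K b`: the algorithm `A` terminates on `K`, and the total number of bitflips over
all its column additions is `b`. -/
def Bitflips {V : Type*} [DecidableEq V] : Algorithm → FilteredComplex V → ℕ → Prop
  | .twist, K, b => ClearingRun false K b
  | .swap, K, b => ClearingRun true K b
  | .retrospective, K, b => RetroRun K b

/-! ### The algorithms are deterministic -/

theorem ForLoop.unique {α S : Type*} {body : α → S → S → Prop}
    (hb : ∀ a s t t', body a s t → body a s t' → t = t') :
    ∀ (l : List α) (s t t' : S), ForLoop body l s t → ForLoop body l s t' → t = t'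
  | [], _, _, _, h, h' => h.symm.trans h'
  | a :: l, s, t, t', ⟨u, hu, h⟩, ⟨u', hu', h'⟩ => by
    obtain rfl := hb a s u u' hu hu'
    exact ForLoop.unique hb l u t t' h h'

theorem ReduceColumn.unique {swaps : Bool} {j : Fin N} {s t t' : State N}
    (h : ReduceColumn swaps j s t) (h' : ReduceColumn swaps j s t') : t = t' := by
  induction h with
  | done s hs =>
    cases h' with
    | done => rfl
    | step _ _ k hkj hk => exact absurd hk (hs k hkj)
  | step s t k hkj hk hmin _ ih =>
    cases h' with
    | done _ hs => exact absurd hk (hs k hkj)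
    | step _ _ k' hkj' hk' hmin' h' =>
      obtain rfl : k = k' := le_antisymm (not_lt.1 fun hlt => hmin _ hlt hk')
        (not_lt.1 fun hlt => hmin' _ hlt hk)
      exact ih h'

theorem Reduce.unique {j : Fin N} {s t t' : RetroState N}
    (h : Reduce j s t) (h' : Reduce j s t') : t = t' := by
  induction h generalizing t' with
  | done j s hs =>
    cases h' with
    | done => rfl
    | step _ l k _ _ _ hl => exact absurd hl (hs l k)
  | step j l k s u t hl hmax _ _ ih1 ih2 =>
    cases h' with
    | done _ _ hs => exact absurd hl (hs l k)
    | step _ l' k' _ u' _ hl' hmax' hrec' h' =>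
      obtain rfl : l = l' := le_antisymm (hmax' _ _ hl) (hmax _ _ hl')
      obtain rfl : k = k' := Option.some.inj (hl.2.1.symm.trans hl'.2.1)
      obtain rfl := ih1 hrec'
      exact ih2 h'

/-- The number of bitflips is determined by the algorithm and the filtered complex. -/
theorem Bitflips.unique {V : Type*} [DecidableEq V] {A : Algorithm} {K : FilteredComplex V}
    {b b' : ℕ} (h : Bitflips A K b) (h' : Bitflips A K b') : b = b' := by
  have key : ∀ swaps, ClearingRun swaps K b → ClearingRun swaps K b' → b = b' := by
    rintro swaps ⟨t, ht, rfl⟩ ⟨t', ht', rfl⟩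
    rw [ForLoop.unique ?_ _ _ _ _ ht ht']
    rintro j s _ _ ⟨u, hu, rfl⟩ ⟨u', hu', rfl⟩
    rw [hu.unique hu']
  cases A with
  | twist => exact key _ h h'
  | swap => exact key _ h h'
  | retrospective =>
    obtain ⟨t, ht, rfl⟩ := h
    obtain ⟨t', ht', rfl⟩ := h'
    rw [ForLoop.unique (fun _ _ _ _ g g' => g.unique g') _ _ _ _ ht ht']

end MatrixReduction

/-! Reducing the edge columns of a graph means walking along paths: a column `{y, v}` with pivot `v`
is replaced by `{y, v'}` when the column `{v', v}` is added. Twist and swap leave path edges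
unreduced below their pivot, so a column that meets the end of a long path has to walk all the way
back. Retrospective reduction shortens every path column to `{0, v}`, so that a single addition
suffices, but it may pay for this with fill-in elsewhere. Both effects are turned into examples.

Retrospective is cheap on `pathGraph`: a path of `m` edges whose last vertex has the largest index,
and `m` further edges from that vertex to vertices below the path (apart from its start `0`). For
twist and swap each of these `m` edges walks down the whole path, at 2 bitflips per step. All
columns have two entries, so no exchange ever takes place (`exists_reduceColumn_walk`,
`PathInv.exists_processColumn`). For retrospective every edge costs at most one addition of a column
`{0, v}` (`PathRetroInv.exists_reduce`).

Twist or swap is cheap on the cone over the tree `switchGraph b`. A triangle over a graph edge has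
two cone edges as its top entries, so triangle columns reduce like graph edges. The third entry, a
base edge, lies below them and records which triangles were summed. Star edges from an extra vertex
come before all other edges and make every base edge and cone edge positive; hence these are not
removed by the retrospective compression. The reduced triangles over the path therefore accumulate
`1, 2, …, m` base entries, and retrospective pays quadratically (`ConeRetroInv.exists_reduce_tri`).

The tree also contains a switch. Two triangles over edges meeting at vertex `2 * m + 3` add up to a
column with four entries and pivot `2 * m + 2`, with remaining top entry `switchVertex b m`. The
next triangle has the same pivot, three entries, and remaining top entry `switchVertex (!b) m`.
Twist keeps the longer column in place, swap the shorter one; the sum is the same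
(`SwitchInv.exists_processColumn_second`). The `m` triangles after that all add the column that was
kept and so inherit its remaining entry. If it is `1`, they are reduced at once; if it is `2 * m +
1`, the end of the path, each walks down `m` columns with three entries
(`SwitchInv.exists_processColumn_last`). The Boolean `b` decides which of the two algorithms gets
the good entry. The edges cost at most 4 bitflips each (`EdgeInv.exists_processColumn`), so the
favoured algorithm is linear. -/

namespace MatrixReduction

variable {N : ℕ}

/-! ### Columns as finite sets of natural numbers -/

/-- The support of column `j` as a set of natural numbers, empty if there is no column `j`. -/
def cols (R : Matrix (Fin N) (Fin N) (ZMod 2)) (j : ℕ) : Finset ℕ :=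
  if h : j < N then (support R ⟨j, h⟩).map Fin.valEmbedding else ∅

theorem mem_cols {R : Matrix (Fin N) (Fin N) (ZMod 2)} {i j : ℕ} :
    i ∈ cols R j ↔ ∃ (hi : i < N) (hj : j < N), R ⟨i, hi⟩ ⟨j, hj⟩ ≠ 0 := by
  unfold cols
  split_ifs with h
  · simp only [Finset.mem_map, support, Finset.mem_filter, Finset.mem_univ, true_and,
      Fin.valEmbedding_apply]
    constructor
    · rintro ⟨a, ha, rfl⟩
      exact ⟨a.2, h, ha⟩
    · rintro ⟨hi, hj, h'⟩
      exact ⟨⟨i, hi⟩, h', rfl⟩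
  · simp [h]

theorem val_mem_cols {R : Matrix (Fin N) (Fin N) (ZMod 2)} {i j : Fin N} :
    (i : ℕ) ∈ cols R j ↔ R i j ≠ 0 := by
  simp [mem_cols]

theorem lt_of_mem_cols {R : Matrix (Fin N) (Fin N) (ZMod 2)} {i j : ℕ} (h : i ∈ cols R j) :
    i < N :=
  (mem_cols.1 h).1

theorem colSize_eq (R : Matrix (Fin N) (Fin N) (ZMod 2)) (j : Fin N) :
    colSize R j = (cols R j).card := by
  simp [colSize, cols]

theorem cols_congr {R R' : Matrix (Fin N) (Fin N) (ZMod 2)} {j j' : Fin N}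
    (h : ∀ i, R i j = R' i j') : cols R j = cols R' j' := by
  ext i
  simp [mem_cols, h]

/-- Read as a greatest element of a set of naturals, the pivot of a zero column simply does not
exist, and `⊥` needs no separate treatment. -/
theorem pivot_eq_iff {R : Matrix (Fin N) (Fin N) (ZMod 2)} {i j : Fin N} :
    pivot R j = (i : WithBot (Fin N)) ↔ IsGreatest (cols R j : Set ℕ) i := by
  have hm : ∀ a, a ∈ support R j ↔ (a : ℕ) ∈ cols R j := fun a => by
    simp [val_mem_cols, support]
  constructor
  · intro h
    refine ⟨(hm i).1 (Finset.mem_of_max h), fun x hx => ?_⟩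
    have hx' : (⟨x, lt_of_mem_cols hx⟩ : Fin N) ∈ support R j := (hm _).2 hx
    exact Fin.le_def.1 (Finset.le_max_of_eq hx' h)
  · intro h
    refine le_antisymm (Finset.max_le fun a ha => ?_) (Finset.le_max ((hm i).2 h.1))
    exact WithBot.coe_le_coe.2 (h.2 ((hm a).1 ha))

theorem samePivot_iff {R : Matrix (Fin N) (Fin N) (ZMod 2)} {k j : Fin N} :
    SamePivot R k j ↔
      ∃ q, IsGreatest (cols R k : Set ℕ) q ∧ IsGreatest (cols R j : Set ℕ) q := by
  constructor
  · rintro ⟨h, hne⟩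
    obtain ⟨q, hq⟩ := WithBot.ne_bot_iff_exists.1 hne
    exact ⟨q, pivot_eq_iff.1 (h.trans hq.symm), pivot_eq_iff.1 hq.symm⟩
  · rintro ⟨q, hk, hj⟩
    have hq := lt_of_mem_cols hk.1
    have h1 := (pivot_eq_iff (i := ⟨q, hq⟩)).2 hk
    have h2 := (pivot_eq_iff (i := ⟨q, hq⟩)).2 hj
    exact ⟨h1.trans h2.symm, by simp [h2]⟩

theorem add_ne_zero_iff_zmod_two :
    ∀ a b : ZMod 2, a + b ≠ 0 ↔ (a ≠ 0 ∧ ¬ b ≠ 0) ∨ (b ≠ 0 ∧ ¬ a ≠ 0) := by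
  decide

theorem cols_addColumn (R : Matrix (Fin N) (Fin N) (ZMod 2)) (k j : Fin N) :
    cols (addColumn R k j) = Function.update (cols R) j (symmDiff (cols R j) (cols R k)) := by
  funext a
  ext i
  rcases eq_or_ne a j with rfl | h
  · rw [Function.update_self, Finset.mem_symmDiff]
    by_cases hi : i < N
    · lift i to Fin N using hi
      simp only [val_mem_cols]
      rw [← add_ne_zero_iff_zmod_two]
      simp [addColumn]
    · simp [mem_cols, hi]
  · rw [Function.update_of_ne h]
    have : ∀ ha, (⟨a, ha⟩ : Fin N) ≠ j := fun ha e => h (by rw [← e])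
    simp [mem_cols, addColumn, this]

theorem cols_swapColumns (R : Matrix (Fin N) (Fin N) (ZMod 2)) (k j : Fin N) :
    cols (swapColumns R k j) =
      Function.update (Function.update (cols R) k (cols R j)) j (cols R k) := by
  funext a
  rcases eq_or_ne a j with rfl | h
  · rw [Function.update_self]
    exact cols_congr fun i => by simp [swapColumns]
  rw [Function.update_of_ne h]
  rcases eq_or_ne a k with rfl | h'
  · rw [Function.update_self]
    exact cols_congr fun i => by simp [swapColumns]
  rw [Function.update_of_ne h']
  by_cases ha : a < N
  · lift a to Fin N using ha
    refine cols_congr fun i => ?_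
    simp only [ne_eq, Fin.val_inj] at h h'
    simp [swapColumns, Equiv.swap_apply_of_ne_of_ne h' h]
  · simp [cols, ha]

theorem cols_clear (s : State N) (j : Fin N) (i : ℕ) :
    (IsGreatest (cols s.R j : Set ℕ) i → cols (s.clear j).R i = ∅) ∧
    (¬ IsGreatest (cols s.R j : Set ℕ) i → cols (s.clear j).R i = cols s.R i) := by
  constructor
  · intro h
    ext a
    simp only [mem_cols, State.clear, Matrix.of_apply, pivot_eq_iff, h, if_true]
    simp
  · intro h
    ext a
    simp only [mem_cols, State.clear, Matrix.of_apply, pivot_eq_iff, h, if_false]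

/-! ### Single steps of the twist and swap reduction -/

theorem ReduceColumn.of_pivot {swaps : Bool} {s : State N} {j : Fin N}
    (h : ∀ q, IsGreatest (cols s.R j : Set ℕ) q →
      ∀ k : ℕ, k < j → ¬ IsGreatest (cols s.R k : Set ℕ) q) :
    ReduceColumn swaps j s s :=
  .done s fun k hk hp => by
    obtain ⟨q, h1, h2⟩ := samePivot_iff.1 hp
    exact h q h2 k hk h1

/-- Uniqueness of the earlier column with pivot `q` settles the minimality demanded by
`ReduceColumn.step`. The postcondition `Q` is passed through so that several additions can be
chained. -/
theorem ReduceColumn.exists_of_step {swaps : Bool} {s : State N} {j k : Fin N} {q : ℕ}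
    {Q : State N → Prop} (hkj : k < j)
    (hk : IsGreatest (cols s.R k : Set ℕ) q) (hj : IsGreatest (cols s.R j : Set ℕ) q)
    (huniq : ∀ k' : ℕ, k' < j → IsGreatest (cols s.R k' : Set ℕ) q → k' = k)
    (h : ∃ t, ReduceColumn swaps j (s.step swaps k j) t ∧ Q t) :
    ∃ t, ReduceColumn swaps j s t ∧ Q t := by
  obtain ⟨t, ht, hQ⟩ := h
  refine ⟨t, .step s t k hkj (samePivot_iff.2 ⟨q, hk, hj⟩) (fun k' hk' hp => ?_) ht, hQ⟩
  obtain ⟨q', h1, h2⟩ := samePivot_iff.1 hp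
  obtain rfl := h2.unique hj
  have := huniq k' (hk'.trans hkj) h1
  exact absurd hk' (by simp [Fin.lt_def, this])

theorem step_of_not_swap {swaps : Bool} {s : State N} {j k : Fin N}
    (h : swaps = false ∨ (cols s.R k).card ≤ (cols s.R j).card) :
    cols (s.step swaps k j).R =
        Function.update (cols s.R) j (symmDiff (cols s.R j) (cols s.R k)) ∧
      (s.step swaps k j).flips = s.flips + (cols s.R k).card := by
  have : trySwap swaps s.R k j = s.R := by
    rw [trySwap, if_neg]
    rintro ⟨h1, h2⟩
    rw [colSize_eq, colSize_eq] at h2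
    rcases h with h | h
    · simp [h] at h1
    · omega
  simp [State.step, this, cols_addColumn, colSize_eq]

/-- The sum does not depend on the exchange. What changes is the column that stays behind at `k`,
and the cost; this is the only difference between twist and swap. -/
theorem step_of_swap {s : State N} {j k : Fin N} (hkj : k < j)
    (h : (cols s.R j).card < (cols s.R k).card) :
    cols (s.step true k j).R =
        Function.update (Function.update (cols s.R) k (cols s.R j)) j
          (symmDiff (cols s.R j) (cols s.R k)) ∧
      (s.step true k j).flips = s.flips + (cols s.R j).card := by
  have : trySwap true s.R k j = swapColumns s.R k j := by
    rw [trySwap, if_pos]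
    simpa [colSize_eq] using h
  have hne : (k : ℕ) ≠ j := by
    have := Fin.lt_def.1 hkj
    omega
  simp [State.step, this, cols_addColumn, colSize_eq, cols_swapColumns, hne, symmDiff_comm]

/-- Every column reduction terminates, and the bitflip counter never decreases. -/
theorem ReduceColumn.exists_le (swaps : Bool) (j : Fin N) (s : State N) :
    ∃ t, ReduceColumn swaps j s t ∧ s.flips ≤ t.flips := by
  -- Induction on a strict bound for the rows of column `j`: every addition cancels the common
  -- pivot, and the sum is the same with or without the exchange.
  suffices H : ∀ (n : ℕ) (s : State N), (∀ x ∈ cols s.R j, x < n) →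
      ∃ t, ReduceColumn swaps j s t ∧ s.flips ≤ t.flips from
    H N s fun x hx => lt_of_mem_cols hx
  intro n
  induction n with
  | zero =>
    intro s hs
    exact ⟨s, .of_pivot fun q hq => absurd (hs q hq.1) (by simp), le_rfl⟩
  | succ n ih =>
    intro s hs
    by_cases hex : ∃ k < j, SamePivot s.R k j
    · obtain ⟨k, ⟨hkj, hk⟩, hmin⟩ := WellFounded.has_min
        (wellFounded_lt (α := Fin N)) {k | k < j ∧ SamePivot s.R k j} hex
      have hmin' : ∀ k' < k, ¬ SamePivot s.R k' j := fun k' h1 h2 =>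
        hmin k' ⟨h1.trans hkj, h2⟩ h1
      obtain ⟨q, h1, h2⟩ := samePivot_iff.1 hk
      have hq : q < n + 1 := hs q h2.1
      have hsum : ∀ x ∈ symmDiff (cols s.R j) (cols s.R k), x < n := by
        intro x hx
        have hne : x ≠ q := by
          rintro rfl
          rw [Finset.mem_symmDiff] at hx
          have := h1.1
          have := h2.1
          simp_all
        have hle : x ≤ q := by
          rw [Finset.mem_symmDiff] at hx
          rcases hx with hx | hx
          exacts [h2.2 hx.1, h1.2 hx.1]
        omega
      have key : ∀ x ∈ cols (s.step swaps k j).R j, x < n := by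
        by_cases hsw : swaps = false ∨ (cols s.R k).card ≤ (cols s.R j).card
        · rw [(step_of_not_swap hsw).1, Function.update_self]
          exact hsum
        · simp only [Bool.not_eq_false, not_or, not_le] at hsw
          obtain ⟨rfl, hsw⟩ := hsw
          rw [(step_of_swap hkj hsw).1, Function.update_self]
          exact hsum
      obtain ⟨t, ht, hle⟩ := ih _ key
      exact ⟨t, .step s t k hkj hk hmin' ht, le_trans (Nat.le_add_right _ _) hle⟩
    · exact ⟨s, .done s fun k hk hp => hex ⟨k, hk, hp⟩, le_rfl⟩

theorem ProcessColumn.exists_le (swaps : Bool) (j : Fin N) (s : State N) :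
    ∃ t, ProcessColumn swaps j s t ∧ s.flips ≤ t.flips := by
  obtain ⟨u, hu, hle⟩ := ReduceColumn.exists_le swaps j s
  exact ⟨u.clear j, ⟨u, hu, rfl⟩, hle⟩

/-! ### Loops -/

theorem ForLoop.append {α S : Type*} {body : α → S → S → Prop} :
    ∀ {l l' : List α} {s u t : S}, ForLoop body l s u → ForLoop body l' u t →
      ForLoop body (l ++ l') s t
  | [], _, _, _, _, h, h' => by
    obtain rfl : _ = _ := h
    exact h'
  | _ :: _, _, _, _, _, ⟨v, hv, h⟩, h' => ⟨v, hv, h.append h'⟩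

theorem ForLoop.exists_le {swaps : Bool} :
    ∀ (l : List (Fin N)) (s : State N),
      ∃ t, ForLoop (ProcessColumn swaps) l s t ∧ s.flips ≤ t.flips
  | [], s => ⟨s, rfl, le_rfl⟩
  | a :: l, s => by
    obtain ⟨u, hu, h1⟩ := ProcessColumn.exists_le swaps a s
    obtain ⟨t, ht, h2⟩ := ForLoop.exists_le l u
    exact ⟨t, ⟨u, hu, ht⟩, h1.trans h2⟩

/-- Loop rule for a loop over the indices that satisfy `p`, from left to right. -/
theorem ForLoop.exists_of_invariant {S : Type*} {body : Fin N → S → S → Prop}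
    (p : Fin N → Bool) (Inv : ℕ → S → Prop)
    (hp : ∀ (i : Fin N) s, p i = true → Inv i s → ∃ t, body i s t ∧ Inv (i + 1) t)
    (hn : ∀ (i : Fin N) s, p i = false → Inv i s → Inv (i + 1) s)
    {s : S} (hs : Inv 0 s) :
    ∃ t, ForLoop body ((List.finRange N).filter p) s t ∧ Inv N t := by
  suffices H : ∀ (d k : ℕ), k + d = N → ∀ s, Inv k s →
      ∃ t, ForLoop body (((List.finRange N).drop k).filter p) s t ∧ Inv N t by
    simpa using H N 0 (by simp) s hs
  intro d
  induction d with
  | zero =>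
    rintro k hk s hs
    obtain rfl : k = N := hk
    refine ⟨s, ?_, hs⟩
    rw [List.drop_of_length_le (by simp)]
    exact rfl
  | succ d ih =>
    intro k hk s hs
    have hkN : k < N := by omega
    rw [List.drop_eq_getElem_cons (by simpa using hkN), List.getElem_finRange]
    cases hpk : p ⟨k, hkN⟩ with
    | false =>
      have := hn ⟨k, hkN⟩ s hpk hs
      obtain ⟨t, ht, h⟩ := ih (k + 1) (by omega) s this
      exact ⟨t, by simpa [List.filter_cons, hpk] using ht, h⟩
    | true =>
      obtain ⟨u, hu, h'⟩ := hp ⟨k, hkN⟩ s hpk hs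
      obtain ⟨t, ht, h⟩ := ih (k + 1) (by omega) u h'
      refine ⟨t, ?_, h⟩
      simp only [List.filter_cons, Fin.cast_mk, hpk, if_true]
      exact ⟨u, hu, ht⟩

/-! ### Filtered complexes from lists of simplices -/

/-- A list of simplices in which the facets of every simplex precede it. The facets of the `j`-th
simplex are those with index in `facets j`. -/
structure SimplexList where
  size : ℕ
  simplex : ℕ → Finset ℕ
  facets : ℕ → Finset ℕ
  nonempty : ∀ j < size, (simplex j).Nonempty
  injective : ∀ i < size, ∀ j < size, simplex i = simplex j → i = j
  isFacet : ∀ j < size, ∀ i ∈ facets j, i < j ∧ ∃ x ∈ simplex j, simplex i = (simplex j).erase x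
  exists_facet : ∀ j < size, ∀ x ∈ simplex j,
    (simplex j).erase x = ∅ ∨ ∃ i ∈ facets j, simplex i = (simplex j).erase x

namespace SimplexList

variable (L : SimplexList)

/-- A proper nonempty subset lies in a facet, and facets come earlier in the list; descend. This is
what makes every initial segment of the list a complex. -/
theorem exists_eq_of_subset (j : ℕ) (hj : j < L.size) (t : Finset ℕ) (ht : t ⊆ L.simplex j)
    (hne : t.Nonempty) : ∃ i ≤ j, L.simplex i = t := by
  induction j using Nat.strong_induction_on with
  | _ j ih =>
    by_cases h : L.simplex j = t
    · exact ⟨j, le_rfl, h⟩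
    · obtain ⟨x, hx, hxt⟩ : ∃ x ∈ L.simplex j, x ∉ t := by
        by_contra! hc
        exact h (subset_antisymm hc ht)
      have hsub : t ⊆ (L.simplex j).erase x := fun y hy =>
        Finset.mem_erase.2 ⟨fun e => hxt (e ▸ hy), ht hy⟩
      rcases L.exists_facet j hj x hx with he | ⟨i, hi, he⟩
      · rw [he, Finset.subset_empty] at hsub
        simp [hsub] at hne
      · have hij := (L.isFacet j hj i hi).1
        obtain ⟨i', hi', h'⟩ := ih i hij (hij.trans hj) (he ▸ hsub)
        exact ⟨i', hi'.trans hij.le, h'⟩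

/-- The filtered complex with the given list of simplices. -/
def toComplex : FilteredComplex ℕ where
  size := L.size
  complex i :=
    { faces := {t | ∃ j < (i : ℕ), L.simplex j = t}
      isRelLowerSet_faces := by
        rintro _ ⟨j, hj, rfl⟩
        have hj' : j < L.size := by omega
        refine ⟨L.nonempty j hj', fun t ht hne => ?_⟩
        obtain ⟨i', hi', h⟩ := L.exists_eq_of_subset j hj' t ht hne
        exact ⟨i', by omega, h⟩ }
  simplex i := L.simplex i
  complex_zero := by
    ext t
    simp only [Fin.val_zero, not_lt_zero, false_and, exists_false, Set.ofPred_false]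
    rfl
  simplex_notMem i := by
    rintro ⟨j, hj, h⟩
    have hj' : j < i := hj
    have := L.injective j (by omega) i i.2 h
    omega
  complex_succ i := by
    ext t
    simp only [Fin.val_succ, Set.mem_ofPred_eq, Fin.val_castSucc, Set.mem_insert_iff]
    constructor
    · rintro ⟨j, hj, rfl⟩
      rcases Nat.lt_succ_iff_lt_or_eq.1 hj with h | rfl
      · exact Or.inr ⟨j, h, rfl⟩
      · exact Or.inl rfl
    · rintro (rfl | ⟨j, hj, rfl⟩)
      · exact ⟨i, by omega, rfl⟩
      · exact ⟨j, by omega, rfl⟩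

/-- A nonzero entry means that one vertex has been dropped; `exists_facet` gives a listed index for
this face, and injectivity identifies it with the row. -/
theorem cols_boundaryMatrix {j : ℕ} (hj : j < L.size) :
    cols L.toComplex.boundaryMatrix j = L.facets j := by
  ext i
  rw [mem_cols]
  constructor
  · rintro ⟨hi, _, h⟩
    simp only [FilteredComplex.boundaryMatrix, Matrix.of_apply, ne_eq, ite_eq_right_iff,
      one_ne_zero, imp_false, not_not] at h
    obtain ⟨hsub, hcard⟩ : L.simplex i ⊆ L.simplex j ∧
      (L.simplex j).card = (L.simplex i).card + 1 := h
    obtain ⟨x, hx, hxi⟩ : ∃ x ∈ L.simplex j, x ∉ L.simplex i := by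
      by_contra! hc
      have := Finset.card_le_card hc
      omega
    have he : L.simplex i = (L.simplex j).erase x := by
      refine Finset.eq_of_subset_of_card_le (fun y hy =>
        Finset.mem_erase.2 ⟨fun e => hxi (e ▸ hy), hsub hy⟩) ?_
      rw [Finset.card_erase_of_mem hx]
      omega
    rcases L.exists_facet j hj x hx with h0 | ⟨i', hi', h'⟩
    · have := L.nonempty i hi
      rw [he, h0] at this
      simp at this
    · have hlt := (L.isFacet j hj i' hi').1
      rwa [← L.injective i' (hlt.trans hj) i hi (h'.trans he.symm)]
  · intro h
    obtain ⟨hlt, x, hx, he⟩ := L.isFacet j hj i h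
    refine ⟨hlt.trans hj, hj, ?_⟩
    simp only [FilteredComplex.boundaryMatrix, Matrix.of_apply, ne_eq, ite_eq_right_iff,
      one_ne_zero, imp_false, not_not]
    change L.simplex i ⊆ L.simplex j ∧ (L.simplex j).card = (L.simplex i).card + 1
    rw [he]
    refine ⟨Finset.erase_subset _ _, ?_⟩
    rw [Finset.card_erase_of_mem hx]
    have := Finset.card_pos.2 ⟨x, hx⟩
    omega

end SimplexList

/-! ### Ordered pairs and triples as vertex sets -/

theorem pair_eq_pair_of_lt {a b c d : ℕ} (h1 : a < b) (h2 : c < d)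
    (h : ({a, b} : Finset ℕ) = {c, d}) : a = c ∧ b = d := by
  simp only [Finset.ext_iff, Finset.mem_insert, Finset.mem_singleton] at h
  have := h a; have := h b; have := h c; have := h d
  omega

theorem triple_eq_triple_of_lt {a b c d e : ℕ} (h1 : a < b) (h2 : c < d) (h3 : b < e) (h4 : d < e)
    (h : ({a, b, e} : Finset ℕ) = {c, d, e}) : a = c ∧ b = d := by
  simp only [Finset.ext_iff, Finset.mem_insert, Finset.mem_singleton] at h
  have := h a; have := h b; have := h c; have := h d
  omega

theorem card_triple_of_lt {a b c : ℕ} (h1 : a < b) (h2 : b < c) :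
    ({a, b, c} : Finset ℕ).card = 3 := by
  rw [Finset.card_eq_three]
  exact ⟨a, b, c, by omega, by omega, by omega, rfl⟩

theorem card_pair_of_lt {a b : ℕ} (h1 : a < b) : ({a, b} : Finset ℕ).card = 2 :=
  Finset.card_pair (by omega)

/-! ### Graphs and cones over graphs -/

/-- A graph on the vertices `0, …, n - 1` with `M` numbered edges. -/
structure EdgeList where
  n : ℕ
  M : ℕ
  lo : ℕ → ℕ
  hi : ℕ → ℕ
  lo_lt_hi : ∀ t < M, lo t < hi t
  hi_lt : ∀ t < M, hi t < n
  injective : ∀ t < M, ∀ t' < M, lo t = lo t' → hi t = hi t' → t = t'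

namespace EdgeList

variable (G : EdgeList)

/-- The graph as a filtered complex: first all vertices, then all edges. -/
def graph : SimplexList where
  size := G.n + G.M
  simplex i := if i < G.n then {i} else {G.lo (i - G.n), G.hi (i - G.n)}
  facets i := if i < G.n then ∅ else {G.lo (i - G.n), G.hi (i - G.n)}
  nonempty j _ := by split_ifs <;> simp
  injective i hi j hj h := by
    by_cases h1 : i < G.n <;> by_cases h2 : j < G.n <;> simp only [h1, h2, if_true, if_false] at h
    · simpa using h
    · have := congrArg Finset.card h
      rw [card_pair_of_lt (G.lo_lt_hi _ (by omega))] at this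
      simp at this
    · have := congrArg Finset.card h
      rw [card_pair_of_lt (G.lo_lt_hi _ (by omega))] at this
      simp at this
    · have := pair_eq_pair_of_lt (G.lo_lt_hi _ (by omega)) (G.lo_lt_hi _ (by omega)) h
      have := G.injective _ (by omega) _ (by omega) this.1 this.2
      omega
  isFacet j hj i hi := by
    by_cases h : j < G.n <;> simp only [h, if_true, if_false] at hi ⊢
    · simp at hi
    · have h1 := G.lo_lt_hi (j - G.n) (by omega)
      have h2 := G.hi_lt (j - G.n) (by omega)
      simp only [Finset.mem_insert, Finset.mem_singleton] at hi
      rcases hi with rfl | rfl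
      · refine ⟨by omega, G.hi (j - G.n), by simp, ?_⟩
        rw [if_pos (by omega)]
        ext x
        simp
        omega
      · refine ⟨by omega, G.lo (j - G.n), by simp, ?_⟩
        rw [if_pos (by omega)]
        ext x
        simp
        omega
  exists_facet j hj x hx := by
    by_cases h : j < G.n <;> simp only [h, if_true, if_false] at hx ⊢
    · simp at hx
      simp [hx]
    · have h1 := G.lo_lt_hi (j - G.n) (by omega)
      have h2 := G.hi_lt (j - G.n) (by omega)
      right
      simp only [Finset.mem_insert, Finset.mem_singleton] at hx
      rcases hx with rfl | rfl
      · refine ⟨G.hi (j - G.n), by simp, ?_⟩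
        rw [if_pos (by omega)]
        ext x
        simp
        omega
      · refine ⟨G.lo (j - G.n), by simp, ?_⟩
        rw [if_pos (by omega)]
        ext x
        simp
        omega

/-- Index of the first base edge of `G.cone`. -/
def baseStart : ℕ := 2 * G.n + 3

/-- Index of the first cone edge of `G.cone`. -/
def coneStart : ℕ := 2 * G.n + 3 + G.M

/-- Index of the first triangle of `G.cone`. -/
def triStart : ℕ := 3 * G.n + 3 + G.M

/-- The simplices of `G.cone`. -/
def coneSimplex (i : ℕ) : Finset ℕ :=
  if i ≤ G.n + 1 then {i}
  else if i < G.baseStart then {0, i - (G.n + 1)}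
  else if i < G.coneStart then {G.lo (i - G.baseStart) + 1, G.hi (i - G.baseStart) + 1}
  else if i < G.triStart then {i - G.coneStart + 1, G.n + 1}
  else {G.lo (i - G.triStart) + 1, G.hi (i - G.triStart) + 1, G.n + 1}

/-- The boundary of the simplices of `G.cone`. -/
def coneFacets (i : ℕ) : Finset ℕ :=
  if i ≤ G.n + 1 then ∅
  else if i < G.triStart then G.coneSimplex i
  else {G.baseStart + (i - G.triStart), G.coneStart + G.lo (i - G.triStart),
    G.coneStart + G.hi (i - G.triStart)}

theorem cone_cases {i : ℕ} (hi : i < G.triStart + G.M) :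
    i ≤ G.n + 1 ∨ (∃ v ≤ G.n, i = G.n + 2 + v) ∨ (∃ t < G.M, i = G.baseStart + t) ∨
      (∃ v < G.n, i = G.coneStart + v) ∨ ∃ t < G.M, i = G.triStart + t := by
  unfold baseStart coneStart triStart at *
  by_cases h1 : i ≤ G.n + 1
  · exact Or.inl h1
  by_cases h2 : i < 2 * G.n + 3
  · exact Or.inr (Or.inl ⟨i - (G.n + 2), by omega, by omega⟩)
  by_cases h3 : i < 2 * G.n + 3 + G.M
  · exact Or.inr (Or.inr (Or.inl ⟨i - (2 * G.n + 3), by omega, by omega⟩))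
  by_cases h4 : i < 3 * G.n + 3 + G.M
  · exact Or.inr (Or.inr (Or.inr (Or.inl ⟨i - (2 * G.n + 3 + G.M), by omega, by omega⟩)))
  · exact Or.inr (Or.inr (Or.inr (Or.inr ⟨i - (3 * G.n + 3 + G.M), by omega, by omega⟩)))

theorem coneSimplex_vertex {i : ℕ} (h : i ≤ G.n + 1) : G.coneSimplex i = {i} := by
  simp [coneSimplex, h]

theorem coneSimplex_star {v : ℕ} (h : v ≤ G.n) : G.coneSimplex (G.n + 2 + v) = {0, v + 1} := by
  rw [coneSimplex, if_neg (by omega), if_pos (by unfold baseStart; omega),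
    show G.n + 2 + v - (G.n + 1) = v + 1 by omega]

theorem coneSimplex_base {t : ℕ} (h : t < G.M) :
    G.coneSimplex (G.baseStart + t) = {G.lo t + 1, G.hi t + 1} := by
  rw [coneSimplex, if_neg (by unfold baseStart; omega), if_neg (by omega),
    if_pos (by unfold baseStart coneStart; omega), Nat.add_sub_cancel_left]

theorem coneSimplex_cone {v : ℕ} (h : v < G.n) :
    G.coneSimplex (G.coneStart + v) = {v + 1, G.n + 1} := by
  rw [coneSimplex, if_neg (by unfold coneStart; omega),
    if_neg (by unfold coneStart baseStart; omega), if_neg (by omega),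
    if_pos (by unfold coneStart triStart; omega), Nat.add_sub_cancel_left]

theorem coneSimplex_tri (t : ℕ) :
    G.coneSimplex (G.triStart + t) = {G.lo t + 1, G.hi t + 1, G.n + 1} := by
  rw [coneSimplex, if_neg (by unfold triStart; omega),
    if_neg (by unfold triStart baseStart; omega),
    if_neg (by unfold triStart coneStart; omega), if_neg (by omega), Nat.add_sub_cancel_left]

theorem coneFacets_vertex {i : ℕ} (h : i ≤ G.n + 1) : G.coneFacets i = ∅ := by
  simp [coneFacets, h]

theorem coneFacets_edge {i : ℕ} (h : G.n + 1 < i) (h' : i < G.triStart) :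
    G.coneFacets i = G.coneSimplex i := by
  rw [coneFacets, if_neg (by omega), if_pos h']

theorem coneFacets_tri (t : ℕ) :
    G.coneFacets (G.triStart + t) =
      {G.baseStart + t, G.coneStart + G.lo t, G.coneStart + G.hi t} := by
  rw [coneFacets, if_neg (by unfold triStart; omega), if_neg (by omega), Nat.add_sub_cancel_left]

/-- The edges of `G.cone` are the pairs `a < b`. -/
theorem coneSimplex_edge {i : ℕ} (h : G.n + 1 < i) (h' : i < G.triStart) :
    ∃ a b, a < b ∧ b ≤ G.n + 1 ∧ G.coneSimplex i = {a, b} := by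
  rcases G.cone_cases (h'.trans_le (Nat.le_add_right _ G.M)) with
    h1 | ⟨v, hv, rfl⟩ | ⟨t, ht, rfl⟩ | ⟨v, hv, rfl⟩ | ⟨t, ht, rfl⟩
  · omega
  · exact ⟨_, _, by omega, by omega, G.coneSimplex_star hv⟩
  · have := G.lo_lt_hi t ht
    have := G.hi_lt t ht
    exact ⟨_, _, by omega, by omega, G.coneSimplex_base ht⟩
  · exact ⟨_, _, by omega, by omega, G.coneSimplex_cone hv⟩
  · omega

theorem card_coneSimplex {i : ℕ} (hi : i < G.triStart + G.M) :
    (G.coneSimplex i).card = if i ≤ G.n + 1 then 1 else if i < G.triStart then 2 else 3 := by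
  by_cases h1 : i ≤ G.n + 1
  · simp [h1, G.coneSimplex_vertex h1]
  rw [if_neg h1]
  by_cases h2 : i < G.triStart
  · obtain ⟨a, b, hab, _, h⟩ := G.coneSimplex_edge (by omega) h2
    rw [if_pos h2, h, card_pair_of_lt hab]
  · rw [if_neg h2]
    obtain ⟨t, rfl⟩ := Nat.exists_eq_add_of_le (not_lt.1 h2)
    have := G.lo_lt_hi t (by omega)
    have := G.hi_lt t (by omega)
    rw [coneSimplex_tri, card_triple_of_lt (by omega) (by omega)]

/-- Cardinality separates the dimensions. Among the edges, exactly the star edges contain `0`, and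
of the others exactly the cone edges contain the apex `n + 1`. -/
theorem coneSimplex_injective {i j : ℕ} (hi : i < G.triStart + G.M) (hj : j < G.triStart + G.M)
    (h : G.coneSimplex i = G.coneSimplex j) : i = j := by
  wlog hij : i ≤ j generalizing i j
  · exact (this hj hi h.symm (by omega)).symm
  have hc := congrArg Finset.card h
  rw [G.card_coneSimplex hi, G.card_coneSimplex hj] at hc
  replace hc : (i ≤ G.n + 1 ↔ j ≤ G.n + 1) ∧ (i < G.triStart ↔ j < G.triStart) := by
    have : G.n + 1 < G.triStart := by unfold triStart; omega
    split_ifs at hc <;> omega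
  rcases G.cone_cases hi with h1 | ⟨v, hv, rfl⟩ | ⟨t, ht, rfl⟩ | ⟨v, hv, rfl⟩ | ⟨t, ht, rfl⟩ <;>
  rcases G.cone_cases hj with h2 | ⟨v', hv', rfl⟩ | ⟨t', ht', rfl⟩ | ⟨v', hv', rfl⟩ | ⟨t', ht', rfl⟩ <;>
  try (exfalso; clear h; simp only [baseStart, coneStart, triStart] at *; omega)
  · rw [G.coneSimplex_vertex h1, G.coneSimplex_vertex h2] at h
    simpa using h
  · rw [G.coneSimplex_star hv, G.coneSimplex_star hv'] at h
    have := pair_eq_pair_of_lt (by omega) (by omega) h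
    omega
  · rw [G.coneSimplex_star hv, G.coneSimplex_base ht'] at h
    have := G.lo_lt_hi t' ht'
    have := pair_eq_pair_of_lt (by omega) (by omega) h
    omega
  · rw [G.coneSimplex_star hv, G.coneSimplex_cone hv'] at h
    have := pair_eq_pair_of_lt (by omega) (by omega) h
    omega
  · rw [G.coneSimplex_base ht, G.coneSimplex_base ht'] at h
    have := G.lo_lt_hi t' ht'
    have := G.lo_lt_hi t ht
    have := pair_eq_pair_of_lt (by omega) (by omega) h
    have := G.injective t ht t' ht' (by omega) (by omega)
    omega
  · rw [G.coneSimplex_base ht, G.coneSimplex_cone hv'] at h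
    have := G.lo_lt_hi t ht
    have := G.hi_lt t ht
    have := pair_eq_pair_of_lt (by omega) (by omega) h
    omega
  · rw [G.coneSimplex_cone hv, G.coneSimplex_cone hv'] at h
    have := pair_eq_pair_of_lt (by omega) (by omega) h
    omega
  · rw [G.coneSimplex_tri, G.coneSimplex_tri] at h
    have := G.lo_lt_hi t' ht'
    have := G.lo_lt_hi t ht
    have := G.hi_lt t ht
    have := G.hi_lt t' ht'
    have := triple_eq_triple_of_lt (by omega) (by omega) (by omega) (by omega) h
    have := G.injective t ht t' ht' (by omega) (by omega)
    omega

/-- The cone over the graph, together with a star: the vertices `0, …, n + 1`, the star edges from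
`0` to all other vertices, the edges of the graph with vertices shifted by one, the cone edges from
`n + 1` to the vertices of the graph, and the triangles spanned by `n + 1` and the edges of the
graph. -/
def cone : SimplexList where
  size := G.triStart + G.M
  simplex := G.coneSimplex
  facets := G.coneFacets
  nonempty j hj := by
    rw [← Finset.card_pos, G.card_coneSimplex hj]
    split_ifs <;> simp
  injective i hi j hj h := G.coneSimplex_injective hi hj h
  isFacet j hj i hi := by
    by_cases h1 : j ≤ G.n + 1
    · simp [G.coneFacets_vertex h1] at hi
    by_cases h2 : j < G.triStart
    · rw [G.coneFacets_edge (by omega) h2] at hi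
      obtain ⟨a, b, hab, hb, h⟩ := G.coneSimplex_edge (by omega) h2
      rw [h] at hi ⊢
      simp only [Finset.mem_insert, Finset.mem_singleton] at hi
      rcases hi with rfl | rfl
      · refine ⟨by omega, b, by simp, ?_⟩
        rw [G.coneSimplex_vertex (by omega)]
        ext x
        simp
        omega
      · refine ⟨by omega, a, by simp, ?_⟩
        rw [G.coneSimplex_vertex (by omega)]
        ext x
        simp
        omega
    · obtain ⟨t, rfl⟩ := Nat.exists_eq_add_of_le (not_lt.1 h2)
      have ht : t < G.M := by omega
      have := G.lo_lt_hi t ht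
      have := G.hi_lt t ht
      rw [coneFacets_tri] at hi
      rw [coneSimplex_tri]
      simp only [Finset.mem_insert, Finset.mem_singleton] at hi
      rcases hi with rfl | rfl | rfl
      · refine ⟨by unfold baseStart triStart; omega, G.n + 1, by simp, ?_⟩
        rw [G.coneSimplex_base ht]
        ext x
        simp
        omega
      · refine ⟨by unfold coneStart triStart; omega, G.hi t + 1, by simp, ?_⟩
        rw [G.coneSimplex_cone (by omega)]
        ext x
        simp
        omega
      · refine ⟨by unfold coneStart triStart; omega, G.lo t + 1, by simp, ?_⟩
        rw [G.coneSimplex_cone (by omega)]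
        ext x
        simp
        omega
  exists_facet j hj x hx := by
    by_cases h1 : j ≤ G.n + 1
    · rw [G.coneSimplex_vertex h1] at hx ⊢
      simp at hx
      simp [hx]
    right
    by_cases h2 : j < G.triStart
    · rw [G.coneFacets_edge (by omega) h2]
      obtain ⟨a, b, hab, hb, h⟩ := G.coneSimplex_edge (by omega) h2
      rw [h] at hx ⊢
      simp only [Finset.mem_insert, Finset.mem_singleton] at hx
      rcases hx with rfl | rfl
      · refine ⟨b, by simp, ?_⟩
        rw [G.coneSimplex_vertex (by omega)]
        ext x
        simp
        omega
      · refine ⟨a, by simp, ?_⟩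
        rw [G.coneSimplex_vertex (by omega)]
        ext x
        simp
        omega
    · obtain ⟨t, rfl⟩ := Nat.exists_eq_add_of_le (not_lt.1 h2)
      have ht : t < G.M := by omega
      have := G.lo_lt_hi t ht
      have := G.hi_lt t ht
      rw [coneSimplex_tri] at hx
      rw [coneFacets_tri, coneSimplex_tri]
      simp only [Finset.mem_insert, Finset.mem_singleton] at hx
      rcases hx with rfl | rfl | rfl
      · refine ⟨G.coneStart + G.hi t, by simp, ?_⟩
        rw [G.coneSimplex_cone (by omega)]
        ext x
        simp
        omega
      · refine ⟨G.coneStart + G.lo t, by simp, ?_⟩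
        rw [G.coneSimplex_cone (by omega)]
        ext x
        simp
        omega
      · refine ⟨G.baseStart + t, by simp, ?_⟩
        rw [G.coneSimplex_base ht]
        ext x
        simp
        omega

theorem dim_graph (i : Fin G.graph.toComplex.size) :
    G.graph.toComplex.dim i = if (i : ℕ) < G.n then 0 else 1 := by
  change (G.graph.simplex i).card - 1 = _
  have hi : (i : ℕ) < G.n + G.M := i.2
  simp only [graph]
  split_ifs with h
  · simp
  · rw [card_pair_of_lt (G.lo_lt_hi _ (by omega))]

theorem dim_cone (i : Fin G.cone.toComplex.size) :
    G.cone.toComplex.dim i =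
      if (i : ℕ) ≤ G.n + 1 then 0 else if (i : ℕ) < G.triStart then 1 else 2 := by
  change (G.coneSimplex i).card - 1 = _
  rw [G.card_coneSimplex i.2]
  split_ifs <;> rfl

theorem decreasingDimOrder_graph (hM : 0 < G.M) :
    G.graph.toComplex.decreasingDimOrder =
      (List.finRange _).filter (fun j => G.graph.toComplex.dim j = 1) ++
      (List.finRange _).filter (fun j => G.graph.toComplex.dim j = 0) := by
  have : G.graph.toComplex.maxDim = 1 := by
    refine le_antisymm (Finset.sup_le fun i _ => ?_) ?_
    · rw [dim_graph]
      split_ifs <;> omega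
    · have hn : G.n < G.graph.toComplex.size := Nat.lt_add_of_pos_right hM
      refine le_trans ?_ (Finset.le_sup (f := G.graph.toComplex.dim)
        (Finset.mem_univ ⟨G.n, hn⟩))
      rw [dim_graph]
      simp
  simp [FilteredComplex.decreasingDimOrder, this, List.range_succ]

theorem decreasingDimOrder_cone (hM : 0 < G.M) :
    G.cone.toComplex.decreasingDimOrder =
      (List.finRange _).filter (fun j => G.cone.toComplex.dim j = 2) ++
      ((List.finRange _).filter (fun j => G.cone.toComplex.dim j = 1) ++
      (List.finRange _).filter (fun j => G.cone.toComplex.dim j = 0)) := by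
  have : G.cone.toComplex.maxDim = 2 := by
    refine le_antisymm (Finset.sup_le fun i _ => ?_) ?_
    · rw [dim_cone]
      split_ifs <;> omega
    · have hn : G.triStart < G.cone.toComplex.size := Nat.lt_add_of_pos_right hM
      refine le_trans ?_ (Finset.le_sup (f := G.cone.toComplex.dim)
        (Finset.mem_univ ⟨G.triStart, hn⟩))
      rw [dim_cone, if_neg (by simp [triStart]; omega), if_neg (by simp)]
  simp [FilteredComplex.decreasingDimOrder, this, List.range_succ]

end EdgeList

/-! ### Columns with two entries in the top rows -/

/-- The column with entries `E`, to be thought of as rows below `κ`, and `κ + a`, `κ + b`. -/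
def form (κ : ℕ) (E : Finset ℕ) (a b : ℕ) : Finset ℕ := E ∪ {κ + a, κ + b}

section form

variable {κ a b e : ℕ} {E D : Finset ℕ}

theorem mem_form {x : ℕ} : x ∈ form κ E a b ↔ x ∈ E ∨ x = κ + a ∨ x = κ + b := by
  simp only [form, Finset.mem_union, Finset.mem_insert, Finset.mem_singleton]

theorem form_comm (κ : ℕ) (E : Finset ℕ) (a b : ℕ) : form κ E a b = form κ E b a := by
  simp [form, Finset.pair_comm]

theorem isGreatest_form (hE : ∀ x ∈ E, x < κ) (hab : a < b) :
    IsGreatest (form κ E a b : Set ℕ) (κ + b) := by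
  refine ⟨by simp [mem_form], fun x hx => ?_⟩
  rw [Finset.mem_coe, mem_form] at hx
  rcases hx with hx | rfl | rfl
  · have := hE x hx
    omega
  · omega
  · exact le_rfl

theorem card_form (hE : ∀ x ∈ E, x < κ) (hab : a ≠ b) : (form κ E a b).card = E.card + 2 := by
  rw [form, Finset.card_union_of_disjoint, Finset.card_pair (by omega)]
  rw [Finset.disjoint_left]
  intro x hx h
  have := hE x hx
  simp only [Finset.mem_insert, Finset.mem_singleton] at h
  omega

/-- In the top rows this is the addition of two graph edges with the common endpoint `e`; the low
entries are carried along. -/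
theorem symmDiff_form (hE : ∀ x ∈ E, x < κ) (hD : ∀ x ∈ D, x < κ) (hae : a ≠ e) (hbe : b ≠ e)
    (hab : a ≠ b) :
    symmDiff (form κ E a e) (form κ D b e) = form κ (symmDiff E D) a b := by
  ext x
  simp only [Finset.mem_symmDiff, mem_form]
  by_cases hx : x < κ
  · have h1 : x ≠ κ + a := by omega
    have h2 : x ≠ κ + b := by omega
    have h3 : x ≠ κ + e := by omega
    simp [h1, h2, h3]
  · have h1 : x ∉ E := fun h => hx (hE x h)
    have h2 : x ∉ D := fun h => hx (hD x h)
    simp only [h1, h2, false_or, false_and, or_self]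
    omega

theorem symmDiff_subset_Ico {B : ℕ} (hE : E ⊆ Finset.Ico B κ) (hD : D ⊆ Finset.Ico B κ) :
    symmDiff E D ⊆ Finset.Ico B κ := fun x hx => by
  rw [Finset.mem_symmDiff] at hx
  rcases hx with hx | hx
  exacts [hE hx.1, hD hx.1]

theorem lt_of_subset_Ico {B : ℕ} (hE : E ⊆ Finset.Ico B κ) : ∀ x ∈ E, x < κ :=
  fun _ hx => (Finset.mem_Ico.1 (hE hx)).2

end form

/-! ### Processing the columns of top dimension -/

/-- The columns before `T` have no entries in the top rows, and the columns `T + t'` with `t' < t`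
are reduced with pivot `κ + piv t'`. -/
structure TopInv (κ B T : ℕ) (piv : ℕ → ℕ) (t : ℕ) (C : ℕ → Finset ℕ) : Prop where
  low : ∀ k < T, ∀ x ∈ C k, x < κ
  processed : ∀ t' < t, ∃ E ⊆ Finset.Ico B κ, ∃ a < piv t', C (T + t') = form κ E a (piv t')

namespace TopInv

variable {κ B T t : ℕ} {piv : ℕ → ℕ} {C C' : ℕ → Finset ℕ}

theorem congr (h : TopInv κ B T piv t C) (hC : ∀ k < T + t, C' k = C k) :
    TopInv κ B T piv t C' where
  low k hk := by
    rw [hC k (by omega)]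
    exact h.low k hk
  processed t' ht' := by
    rw [hC _ (by omega)]
    exact h.processed t' ht'

/-- The only earlier columns that reach the top rows are the processed ones, so collisions are
governed by `piv` alone. -/
theorem exists_of_isGreatest (h : TopInv κ B T piv t C) {k b : ℕ} (hk : k < T + t)
    (hb : IsGreatest (C k : Set ℕ) (κ + b)) : ∃ t' < t, k = T + t' ∧ b = piv t' := by
  by_cases hkT : k < T
  · have := h.low k hkT _ hb.1
    omega
  · obtain ⟨t', rfl⟩ := Nat.exists_eq_add_of_le (not_lt.1 hkT)
    obtain ⟨E, hE, a, ha, he⟩ := h.processed t' (by omega)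
    rw [he] at hb
    have := hb.unique (isGreatest_form (lt_of_subset_Ico hE) ha)
    exact ⟨t', by omega, rfl, by omega⟩

theorem reduceColumn_self {swaps : Bool} {s : State N} {j : Fin N}
    (h : TopInv κ B T piv t (cols s.R)) (hj : (j : ℕ) = T + t) {E : Finset ℕ} {a b : ℕ}
    (hE : E ⊆ Finset.Ico B κ) (hab : a < b) (hC : cols s.R j = form κ E a b)
    (hb : ∀ t' < t, piv t' ≠ b) : ReduceColumn swaps j s s := by
  refine .of_pivot fun q hq k hk hkq => ?_
  rw [hC] at hq
  obtain rfl := hq.unique (isGreatest_form (lt_of_subset_Ico hE) hab)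
  obtain ⟨t', ht', _, he⟩ := h.exists_of_isGreatest (hj ▸ hk) hkq
  exact hb t' ht' he.symm

theorem exists_of_step {swaps : Bool} {s : State N} {j k : Fin N} {t' : ℕ}
    (h : TopInv κ B T piv t (cols s.R)) (hj : (j : ℕ) = T + t) (ht' : t' < t)
    (hk : (k : ℕ) = T + t') (hinj : ∀ t₁ < t, ∀ t₂ < t, piv t₁ = piv t₂ → t₁ = t₂)
    {E : Finset ℕ} {a : ℕ} (hE : E ⊆ Finset.Ico B κ) (ha : a < piv t')
    (hC : cols s.R j = form κ E a (piv t')) {Q : State N → Prop}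
    (hQ : ∃ u, ReduceColumn swaps j (s.step swaps k j) u ∧ Q u) :
    ∃ u, ReduceColumn swaps j s u ∧ Q u := by
  refine ReduceColumn.exists_of_step (q := κ + piv t') (Fin.lt_def.2 (by omega)) ?_ ?_ ?_ hQ
  · obtain ⟨D, hD, d, hd, he⟩ := h.processed t' ht'
    rw [hk, he]
    exact isGreatest_form (lt_of_subset_Ico hD) hd
  · rw [hC]
    exact isGreatest_form (lt_of_subset_Ico hE) ha
  · intro k' hk' hg
    obtain ⟨t'', ht'', rfl, he⟩ := h.exists_of_isGreatest (hj ▸ hk') hg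
    rw [hk, hinj _ ht' _ ht'' he]

theorem cols_clear_eq {u : State N} {j : Fin N} {E : Finset ℕ} {a b : ℕ}
    (hE : E ⊆ Finset.Ico B κ) (hab : a < b) (hC : cols u.R j = form κ E a b) :
    cols (u.clear j).R = Function.update (cols u.R) (κ + b) ∅ := by
  funext k
  have hg := isGreatest_form (lt_of_subset_Ico hE) hab
  rw [← hC] at hg
  rcases eq_or_ne k (κ + b) with rfl | hk
  · rw [Function.update_self]
    exact (cols_clear u j _).1 hg
  · rw [Function.update_of_ne hk]
    exact (cols_clear u j _).2 fun h => hk (h.unique hg)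

/-- By `hT` the cleared column lies before `T`, so clearing never destroys a processed column. -/
theorem clear {u : State N} {j : Fin N} (h : TopInv κ B T piv t (cols u.R))
    (hj : (j : ℕ) = T + t) {E : Finset ℕ} {a : ℕ} (hE : E ⊆ Finset.Ico B κ) (ha : a < piv t)
    (hC : cols u.R j = form κ E a (piv t)) (hT : κ + piv t < T) :
    TopInv κ B T piv (t + 1) (cols (u.clear j).R) := by
  rw [cols_clear_eq hE ha hC]
  constructor
  · intro k hk x hx
    rcases eq_or_ne k (κ + piv t) with rfl | hk'
    · simp at hx
    · rw [Function.update_of_ne hk'] at hx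
      exact h.low k hk x hx
  · intro t' ht'
    rw [Function.update_of_ne (by omega)]
    rcases Nat.lt_succ_iff_lt_or_eq.1 ht' with h' | rfl
    · exact h.processed t' h'
    · exact ⟨E, hE, a, ha, hj ▸ hC⟩

end TopInv

/-! ### Walking down the long path -/

/-- The vertices of the long path. -/
def chainVertex (m i : ℕ) : ℕ := if i = 0 then 0 else m + 1 + i

theorem chainVertex_zero (m : ℕ) : chainVertex m 0 = 0 := rfl

theorem chainVertex_succ (m i : ℕ) : chainVertex m (i + 1) = m + 2 + i := by
  simp [chainVertex]
  omega

theorem chainVertex_le (m i : ℕ) : chainVertex m i ≤ m + 1 + i := by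
  unfold chainVertex
  split_ifs <;> omega

theorem chainVertex_lt_succ (m i : ℕ) : chainVertex m i < chainVertex m (i + 1) := by
  have := chainVertex_le m i
  rw [chainVertex_succ]
  omega

theorem chainVertex_of_pos {m i : ℕ} (h : 0 < i) : chainVertex m i = m + 1 + i := by
  simp [chainVertex, h.ne']

/-- A column that meets the end of the path walks down to its start. -/
theorem exists_reduceColumn_walk {swaps : Bool} {κ B T t m w y : ℕ} {piv : ℕ → ℕ} {j : Fin N}
    {J : Finset ℕ} (hj : (j : ℕ) = T + t) (hmt : m ≤ t)
    (hpiv : ∀ i < m, piv i = chainVertex m (i + 1))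
    (hinj : ∀ t₁ < t, ∀ t₂ < t, piv t₁ = piv t₂ → t₁ = t₂)
    (hy0 : 0 < y) (hym : y < m + 2) (hy : ∀ t' < t, piv t' ≠ y) (hw : w ≤ J.card + 2) :
    ∀ i ≤ m, ∀ (s : State N) (E : Finset ℕ), TopInv κ B T piv t (cols s.R) →
      (∀ i < m, ∃ D ⊆ Finset.Ico B κ, D.card + 2 = w ∧ Disjoint J D ∧
        cols s.R (T + i) = form κ D (chainVertex m i) (chainVertex m (i + 1))) →
      E ⊆ Finset.Ico B κ → J ⊆ E → cols s.R j = form κ E y (chainVertex m i) →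
      ∃ u, ReduceColumn swaps j s u ∧ (∀ k : ℕ, k ≠ j → cols u.R k = cols s.R k) ∧
        (∃ E' ⊆ Finset.Ico B κ, cols u.R j = form κ E' 0 y) ∧ u.flips = s.flips + w * i := by
  intro i
  induction i with
  | zero =>
    intro _ s E hs _ hE _ hC
    -- At the start of the path the top entries are `0` and `y`, so `y` becomes the pivot, and no
    -- processed column has it.
    rw [chainVertex_zero, form_comm] at hC
    exact ⟨s, hs.reduceColumn_self hj hE hy0 hC hy, fun _ _ => rfl, ⟨E, hE, hC⟩, by simp⟩
  | succ i ih =>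
    intro hi s E hs hch hE hJ hC
    obtain ⟨D, hD, hDw, hJD, hk⟩ := hch i hi
    have hkN : T + i < N := by omega
    -- Since `y ≤ m + 1` lies below every path vertex except `0`, the path entry remains the pivot
    -- throughout the walk.
    have hy' : y < chainVertex m (i + 1) := by
      rw [chainVertex_succ]
      omega
    have hyi : y ≠ chainVertex m i := by
      unfold chainVertex
      split_ifs <;> omega
    have hlt := chainVertex_lt_succ m i
    -- The entries in `J` avoid all path columns and therefore survive. Hence column `j` keeps at
    -- least `w` entries, no exchange occurs, and each step costs exactly `w`.
    have hcard : (cols s.R ((⟨T + i, hkN⟩ : Fin N) : ℕ)).card ≤ (cols s.R j).card := by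
      have := Finset.card_le_card hJ
      rw [hC, hk, card_form (lt_of_subset_Ico hD) hlt.ne,
        card_form (lt_of_subset_Ico hE) hy'.ne]
      omega
    obtain ⟨h1, h2⟩ := step_of_not_swap (swaps := swaps) (Or.inr hcard)
    rw [hC, hk, symmDiff_form (lt_of_subset_Ico hE) (lt_of_subset_Ico hD) hy'.ne hlt.ne hyi] at h1
    rw [hk, card_form (lt_of_subset_Ico hD) hlt.ne, hDw] at h2
    refine hs.exists_of_step (t' := i) (k := ⟨T + i, hkN⟩) (a := y) hj (by omega) rfl hinj hE
      (by rwa [hpiv i hi]) (by rwa [hpiv i hi]) ?_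
    have hne : ∀ k : ℕ, k ≠ j → cols (s.step swaps ⟨T + i, hkN⟩ j).R k = cols s.R k :=
      fun k hk => by rw [h1, Function.update_of_ne hk]
    obtain ⟨u, hu, hcu, hEu, hfu⟩ := ih (by omega) (s.step swaps ⟨T + i, hkN⟩ j) (symmDiff E D)
      (hs.congr fun k hk => hne k (by omega))
      (fun i' hi' => by
        rw [hne _ (by omega)]
        exact hch i' hi')
      (symmDiff_subset_Ico hE hD)
      (fun x hx => by
        rw [Finset.mem_symmDiff]
        exact Or.inl ⟨hJ hx, Finset.disjoint_left.1 hJD hx⟩)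
      (by rw [h1, Function.update_self])
    refine ⟨u, hu, fun k hk => (hcu k hk).trans (hne k hk), hEu, ?_⟩
    rw [hfu, h2]
    ring

/-! ### A graph on which the twist and swap reductions are slow -/

/-- A path together with `m` edges from its last vertex to further vertices. -/
def pathGraph (m : ℕ) (hm : 0 < m) : EdgeList where
  n := 2 * m + 2
  M := 2 * m
  lo t := if t < m then chainVertex m t else 2 + (t - m)
  hi t := if t < m then chainVertex m (t + 1) else chainVertex m m
  lo_lt_hi t ht := by
    split_ifs
    · exact chainVertex_lt_succ m t
    · rw [chainVertex_of_pos hm]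
      omega
  hi_lt t ht := by
    split_ifs
    · rw [chainVertex_succ]
      omega
    · rw [chainVertex_of_pos hm]
      omega
  injective t ht t' ht' := by
    simp only [chainVertex]
    split_ifs <;> omega

/-- The pivots of the edges of `pathGraph`. -/
def pathPivot (m t : ℕ) : ℕ := if t < m then chainVertex m (t + 1) else 2 + (t - m)

theorem pathPivot_injective {m t₁ t₂ : ℕ} (h1 : t₁ < 2 * m) (h2 : t₂ < 2 * m)
    (h : pathPivot m t₁ = pathPivot m t₂) : t₁ = t₂ := by
  simp only [pathPivot, chainVertex_succ] at h
  split_ifs at h <;> omega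

theorem cols_pathGraph {m : ℕ} (hm : 0 < m) {t : ℕ} (ht : t < 2 * m) :
    cols (pathGraph m hm).graph.toComplex.boundaryMatrix (2 * m + 2 + t) =
      form 0 ∅ ((pathGraph m hm).lo t) ((pathGraph m hm).hi t) := by
  rw [SimplexList.cols_boundaryMatrix _ (by simp [EdgeList.graph, pathGraph]; omega)]
  simp [EdgeList.graph, pathGraph, form]

theorem cols_pathGraph_vertex {m : ℕ} (hm : 0 < m) {k : ℕ} (hk : k < 2 * m + 2) :
    cols (pathGraph m hm).graph.toComplex.boundaryMatrix k = ∅ := by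
  rw [SimplexList.cols_boundaryMatrix _ (by simp [EdgeList.graph, pathGraph]; omega)]
  simp [EdgeList.graph, pathGraph, hk]

/-- The state of the twist and swap reductions on `pathGraph` before edge `t` is processed. -/
structure PathInv {m : ℕ} (hm : 0 < m) (t : ℕ) (s : State N) : Prop where
  top : TopInv 0 0 (2 * m + 2) (pathPivot m) t (cols s.R)
  orig : ∀ t' < 2 * m, t' < m ∨ t ≤ t' → cols s.R (2 * m + 2 + t') =
    form 0 ∅ ((pathGraph m hm).lo t') ((pathGraph m hm).hi t')
  flips : 2 * m * (t - m) ≤ s.flips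

/-- Here `κ = B = 0`, so all rows are top rows and the low parts are empty. A path edge has a fresh
pivot; any other edge walks down `m` columns with two entries and ends with pivot `2 + (t - m)`. -/
theorem PathInv.exists_processColumn {swaps : Bool} {m t : ℕ} {hm : 0 < m} {s : State N}
    {j : Fin N} (h : PathInv hm t s) (ht : t < 2 * m) (hj : (j : ℕ) = 2 * m + 2 + t) :
    ∃ u, ProcessColumn swaps j s u ∧ PathInv hm (t + 1) u := by
  have hinj : ∀ t₁ < t, ∀ t₂ < t, pathPivot m t₁ = pathPivot m t₂ → t₁ = t₂ :=
    fun t₁ h1 t₂ h2 => pathPivot_injective (by omega) (by omega)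
  have hpt : ∀ t' < t, pathPivot m t' ≠ pathPivot m t := fun t' ht' he => by
    have := pathPivot_injective (by omega) ht he
    omega
  have hT : 0 + pathPivot m t < 2 * m + 2 := by
    simp only [pathPivot, chainVertex_succ]
    split_ifs <;> omega
  obtain ⟨u, hu, hne, hself, E, hE, a, ha, hC, hfl⟩ : ∃ u, ReduceColumn swaps j s u ∧
      (∀ k : ℕ, k ≠ j → cols u.R k = cols s.R k) ∧ (t < m → cols u.R j = cols s.R j) ∧ ∃ E ⊆ Finset.Ico 0 0, ∃ a < pathPivot m t,
        cols u.R j = form 0 E a (pathPivot m t) ∧ 2 * m * (t + 1 - m) ≤ u.flips := by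
    have hC := h.orig t ht (Or.inr le_rfl)
    rw [← hj] at hC
    by_cases htm : t < m
    · have hp : pathPivot m t = chainVertex m (t + 1) := by simp [pathPivot, htm]
      have hC' : cols s.R j = form 0 ∅ (chainVertex m t) (pathPivot m t) := by
        rw [hC, hp]
        simp [pathGraph, htm]
      have hlt : chainVertex m t < pathPivot m t := hp ▸ chainVertex_lt_succ m t
      refine ⟨s, h.top.reduceColumn_self hj (Finset.empty_subset _) hlt hC' hpt, fun _ _ => rfl,
        fun _ => rfl, ∅, Finset.empty_subset _, _, hlt, hC', ?_⟩
      rw [show t + 1 - m = 0 by omega]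
      simp
    · have hp : pathPivot m t = 2 + (t - m) := by simp [pathPivot, htm]
      have hC' : cols s.R j = form 0 ∅ (pathPivot m t) (chainVertex m m) := by
        rw [hC, hp]
        simp [pathGraph, htm]
      obtain ⟨u, hu, hcu, ⟨E, hE, hCE⟩, hfu⟩ := exists_reduceColumn_walk (swaps := swaps)
        (J := ∅) (w := 2) hj (not_lt.1 htm)
        (fun i hi => by simp [pathPivot, hi]) hinj (by omega) (by omega) hpt (by simp) m le_rfl s ∅
        h.top (fun i hi => ⟨∅, Finset.empty_subset _, by simp, by simp, by
          rw [h.orig i (by omega) (Or.inl hi)]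
          simp [pathGraph, hi]⟩) (Finset.empty_subset _) (Finset.empty_subset _) hC'
      refine ⟨u, hu, hcu, fun h => absurd h htm, E, hE, 0, by omega, hCE, ?_⟩
      rw [hfu, show t + 1 - m = t - m + 1 by omega, mul_add]
      have := h.flips
      omega
  have hcl := TopInv.cols_clear_eq hE ha hC
  refine ⟨_, ⟨u, hu, rfl⟩, (h.top.congr fun k hk => hne k (by omega)).clear hj hE ha hC hT, ?_, hfl⟩
  intro t' ht' hor
  rw [hcl, Function.update_of_ne (by omega)]
  rcases eq_or_ne t' t with rfl | h'
  · rw [← hj, hself (by omega), hj]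
    exact h.orig t' ht' (by omega)
  · rw [hne _ (by omega)]
    exact h.orig t' ht' (by omega)

theorem exists_clearingRun_pathGraph (swaps : Bool) {m : ℕ} (hm : 0 < m) :
    ∃ b, ClearingRun swaps (pathGraph m hm).graph.toComplex b ∧ 2 * m * m ≤ b := by
  obtain ⟨s, hs, hinv⟩ := ForLoop.exists_of_invariant (body := ProcessColumn swaps)
    (fun j => (pathGraph m hm).graph.toComplex.dim j = 1)
    (fun i s => PathInv hm (i - (2 * m + 2)) s)
    (s := ⟨(pathGraph m hm).graph.toComplex.boundaryMatrix, 0⟩)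
    (fun i s hi h => by
      rw [decide_eq_true_eq, EdgeList.dim_graph] at hi
      have hi2 : (i : ℕ) < 2 * m + 2 + 2 * m := i.2
      have hi1 : 2 * m + 2 ≤ (i : ℕ) := by
        by_contra hc
        simp [pathGraph, not_le.1 hc] at hi
      obtain ⟨u, hu, h'⟩ := h.exists_processColumn (swaps := swaps) (j := i) (by omega) (by omega)
      exact ⟨u, hu, by rwa [show (i : ℕ) + 1 - (2 * m + 2) = i - (2 * m + 2) + 1 by omega]⟩)
    (fun i s hi h => by
      rw [decide_eq_false_iff_not, EdgeList.dim_graph] at hi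
      have hi1 : (i : ℕ) < 2 * m + 2 := by
        by_contra hc
        simp [pathGraph, hc] at hi
      rwa [show (i : ℕ) + 1 - (2 * m + 2) = i - (2 * m + 2) by omega])
    { top :=
        { low := fun k hk x hx => by simp [cols_pathGraph_vertex hm hk] at hx
          processed := fun t' ht' => by omega }
      orig := fun t' ht' _ => cols_pathGraph hm ht'
      flips := by simp }
  -- For a lower bound, the vertex columns only have to be processed without decreasing the counter.
  obtain ⟨t, ht, hle⟩ := ForLoop.exists_le (swaps := swaps)
    ((List.finRange _).filter fun j => (pathGraph m hm).graph.toComplex.dim j = 0) s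
  refine ⟨_, ⟨t, ?_, rfl⟩, le_trans ?_ hle⟩
  · rw [EdgeList.decreasingDimOrder_graph _ (by simp [pathGraph]; omega)]
    exact hs.append ht
  · have := hinv.flips
    have e : (pathGraph m hm).graph.toComplex.size - (2 * m + 2) - m = m := by
      change 2 * m + 2 + 2 * m - (2 * m + 2) - m = m
      omega
    rwa [e] at this

/-! ### The cones that separate the twist and swap reductions -/

/-- One of the two vertices `1` and `2 * m + 1`, the latter being the end of the long path. -/
def switchVertex (b : Bool) (m : ℕ) : ℕ := if b then 2 * m + 1 else 1

theorem switchVertex_bounds (b : Bool) {m : ℕ} (hm : 0 < m) :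
    0 < switchVertex b m ∧ switchVertex b m < 2 * m + 2 := by
  unfold switchVertex
  split_ifs <;> omega

theorem switchVertex_ne (b : Bool) {m : ℕ} (hm : 0 < m) :
    switchVertex b m ≠ switchVertex (!b) m := by
  cases b <;> simp [switchVertex] <;> omega

/-- A tree: the long path, three edges around the vertices `2 * m + 2` and `2 * m + 3`, and `m`
edges at the vertex `2 * m + 2`. -/
def switchGraph (b : Bool) (m : ℕ) (hm : 0 < m) : EdgeList where
  n := 2 * m + 4
  M := 2 * m + 3
  lo t := if t < m then chainVertex m t else if t = m then 2 * m + 2 else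
    if t = m + 1 then switchVertex b m else if t = m + 2 then switchVertex (!b) m else
      2 + (t - (m + 3))
  hi t := if t < m then chainVertex m (t + 1) else if t ≤ m + 1 then 2 * m + 3 else 2 * m + 2
  lo_lt_hi t ht := by
    have := chainVertex_lt_succ m t
    have := switchVertex_bounds b hm
    have := switchVertex_bounds (!b) hm
    split_ifs <;> omega
  hi_lt t ht := by
    rw [chainVertex_succ]
    split_ifs <;> omega
  injective t ht t' ht' := by
    have := switchVertex_ne b hm
    have := switchVertex_bounds b hm
    have := switchVertex_bounds (!b) hm
    have : switchVertex (!b) m = 1 ∨ switchVertex (!b) m = 2 * m + 1 := by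
      unfold switchVertex
      split_ifs <;> simp
    simp only [chainVertex]
    intro h1 h2
    split_ifs at h1 h2 <;> omega

/-- The pivots of the triangles of the cone over `switchGraph`. -/
def switchPivot (m t : ℕ) : ℕ :=
  if t < m then chainVertex m (t + 1) else if t = m then 2 * m + 3 else
    if t = m + 1 then 2 * m + 2 else if t = m + 2 then 1 else 2 + (t - (m + 3))

theorem switchPivot_injective {m t₁ t₂ : ℕ} (h1 : t₁ < 2 * m + 3) (h2 : t₂ < 2 * m + 3)
    (h : switchPivot m t₁ = switchPivot m t₂) : t₁ = t₂ := by
  simp only [switchPivot, chainVertex_succ] at h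
  split_ifs at h <;> omega

theorem switchPivot_lt {m t : ℕ} (h : t < 2 * m + 3) : switchPivot m t < 2 * m + 4 := by
  simp only [switchPivot, chainVertex_succ]
  split_ifs <;> omega

/-- The state of the reductions on the cone over `switchGraph` before triangle `t` is processed.
The columns of the base edges, cone edges and triangles start at `B`, `κ` and `T`, and `F` are the
columns of the boundary matrix. -/
structure SwitchInv (b swaps : Bool) {m : ℕ} (hm : 0 < m) (κ B T : ℕ) (F : ℕ → Finset ℕ)
    (t : ℕ) (s : State N) : Prop where
  top : TopInv κ B T (switchPivot m) t (cols s.R)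
  orig : ∀ t' < 2 * m + 3, t' ≤ m ∨ t ≤ t' → cols s.R (T + t') =
    form κ {B + t'} ((switchGraph b m hm).lo t') ((switchGraph b m hm).hi t')
  before : t = m + 2 → cols s.R (T + (m + 1)) =
    form κ {B + m, B + (m + 1)} (switchVertex b m) (2 * m + 2)
  -- After triangle `m + 2`, position `m + 1` holds the original column of that triangle (swap) or
  -- the sum of the two triangles before it (twist).
  after : m + 2 < t → ∃ D ⊆ Finset.Ico B κ, D.card = (if swaps then 1 else 2) ∧
    (∀ x ∈ D, x ≤ B + (m + 2)) ∧ cols s.R (T + (m + 1)) =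
      form κ D (if swaps then switchVertex (!b) m else switchVertex b m) (2 * m + 2)
  -- Clearing reaches only cone edges; the weaker bound `B ≤ k` is enough to know that the star
  -- edges are intact.
  low : ∀ k < T, cols s.R k = F k ∨ (B ≤ k ∧ cols s.R k = ∅)
  flips_le : b = swaps → s.flips ≤ 4 * t + if m + 2 < t then 3 * m else 0
  le_flips : b ≠ swaps → 3 * m * (t - (m + 3)) ≤ s.flips

theorem TopInv.exists_processColumn {swaps : Bool} {κ B T t : ℕ} {piv : ℕ → ℕ} {s u : State N}
    {j : Fin N} (h : TopInv κ B T piv t (cols u.R)) (hj : (j : ℕ) = T + t) {E : Finset ℕ} {a : ℕ}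
    (hu : ReduceColumn swaps j s u) (hE : E ⊆ Finset.Ico B κ) (ha : a < piv t)
    (hC : cols u.R j = form κ E a (piv t)) (hT : κ + piv t < T) :
    ∃ v, ProcessColumn swaps j s v ∧ TopInv κ B T piv (t + 1) (cols v.R) ∧
      (∀ k, cols v.R (T + k) = cols u.R (T + k)) ∧
      (∀ k, cols v.R k = cols u.R k ∨ (κ ≤ k ∧ cols v.R k = ∅)) ∧ v.flips = u.flips := by
  have hcl := TopInv.cols_clear_eq hE ha hC
  refine ⟨_, ⟨u, hu, rfl⟩, h.clear hj hE ha hC hT, fun k => ?_, fun k => ?_, rfl⟩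
  · rw [hcl, Function.update_of_ne (by omega)]
  · rw [hcl]
    rcases eq_or_ne k (κ + piv t) with rfl | hk
    · exact Or.inr ⟨by omega, Function.update_self _ _ _⟩
    · exact Or.inl (Function.update_of_ne hk _ _)

namespace SwitchInv

variable {b swaps : Bool} {m : ℕ} {hm : 0 < m} {κ B T : ℕ} {F : ℕ → Finset ℕ} {t : ℕ} {s : State N}
  {j : Fin N}

/-- Supplies the walk with `w = 3` and the marker `J = {B + x}`: the base entries of the path
triangles are `B + i` with `i < m ≤ x`. -/
theorem chain (h : SwitchInv b swaps hm κ B T F t s) (hκ : κ = B + (2 * m + 3)) {x : ℕ}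
    (hx : m ≤ x) : ∀ i < m, ∃ D ⊆ Finset.Ico B κ, D.card + 2 = 3 ∧ Disjoint {B + x} D ∧
      cols s.R (T + i) = form κ D (chainVertex m i) (chainVertex m (i + 1)) := by
  intro i hi
  refine ⟨{B + i}, ?_, by simp, ?_, ?_⟩
  · rw [Finset.singleton_subset_iff, Finset.mem_Ico]
    omega
  · simp
    omega
  · rw [h.orig i (by omega) (by omega)]
    simp [switchGraph, hi]

theorem exists_processColumn_of_le (h : SwitchInv b swaps hm κ B T F t s)
    (hκ : κ = B + (2 * m + 3)) (hT : T = κ + (2 * m + 4)) (ht : t ≤ m) (hj : (j : ℕ) = T + t) :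
    ∃ u, ProcessColumn swaps j s u ∧ SwitchInv b swaps hm κ B T F (t + 1) u := by
  have hp : switchPivot m t = (switchGraph b m hm).hi t := by
    simp only [switchPivot, switchGraph]
    split_ifs <;> omega
  have hlt := (switchGraph b m hm).lo_lt_hi t (by simp [switchGraph]; omega)
  rw [← hp] at hlt
  have hE : {B + t} ⊆ Finset.Ico B κ := by
    rw [Finset.singleton_subset_iff, Finset.mem_Ico]
    omega
  have hC := h.orig t (by omega) (Or.inr le_rfl)
  rw [← hj, ← hp] at hC
  have hpl := switchPivot_lt (m := m) (t := t) (by omega)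
  obtain ⟨v, hv, h1, h2, h3, h4⟩ := h.top.exists_processColumn (swaps := swaps) (s := s) hj
    (h.top.reduceColumn_self hj hE hlt hC fun t' ht' he => by
      have := switchPivot_injective (by omega) (by omega) he
      omega) hE hlt hC (by omega)
  refine ⟨v, hv, h1, fun t' ht' hor => ?_, fun _ => by omega, fun _ => by omega, fun k hk => ?_,
    fun hb => ?_, fun hb => ?_⟩
  · rw [h2]
    exact h.orig t' ht' (by omega)
  · rcases h3 k with h3 | h3
    · rw [h3]
      exact h.low k hk
    · exact Or.inr ⟨by omega, h3.2⟩
  · have := h.flips_le hb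
    rw [h4]
    split_ifs at this ⊢ <;> omega
  · rw [show t + 1 - (m + 3) = 0 by omega]
    simp

/-- Two columns with three entries collide, so even swap does not exchange them. The sum has four
entries, one more than the triangle that will meet it next. -/
theorem exists_processColumn_first (h : SwitchInv b swaps hm κ B T F (m + 1) s)
    (hκ : κ = B + (2 * m + 3)) (hT : T = κ + (2 * m + 4)) (hj : (j : ℕ) = T + (m + 1)) :
    ∃ u, ProcessColumn swaps j s u ∧ SwitchInv b swaps hm κ B T F (m + 2) u := by
  have hb := switchVertex_bounds b hm
  have hp : switchPivot m (m + 1) = 2 * m + 2 := by simp [switchPivot]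
  have hp' : switchPivot m m = 2 * m + 3 := by simp [switchPivot]
  have hE : {B + (m + 1)} ⊆ Finset.Ico B κ := by
    rw [Finset.singleton_subset_iff, Finset.mem_Ico]
    omega
  have hD : {B + m} ⊆ Finset.Ico B κ := by
    rw [Finset.singleton_subset_iff, Finset.mem_Ico]
    omega
  have hED : symmDiff {B + (m + 1)} {B + m} = ({B + m, B + (m + 1)} : Finset ℕ) := by
    ext x
    simp [Finset.mem_symmDiff]
    omega
  have hC : cols s.R j = form κ {B + (m + 1)} (switchVertex b m) (2 * m + 3) := by
    rw [hj, h.orig _ (by omega) (by omega)]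
    simp [switchGraph]
  have hk : cols s.R (T + m) = form κ {B + m} (2 * m + 2) (2 * m + 3) := by
    rw [h.orig _ (by omega) (by omega)]
    simp [switchGraph]
  have hkN : T + m < N := by omega
  obtain ⟨h1, h2⟩ := step_of_not_swap (swaps := swaps) (s := s) (j := j) (k := ⟨T + m, hkN⟩)
    (Or.inr (by
      rw [hC, hk, card_form (lt_of_subset_Ico hE) (by omega),
        card_form (lt_of_subset_Ico hD) (by omega)]
      simp))
  rw [hC, hk, symmDiff_form (lt_of_subset_Ico hE) (lt_of_subset_Ico hD) (by omega) (by omega)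
    (by omega), hED] at h1
  rw [hk, card_form (lt_of_subset_Ico hD) (by omega), Finset.card_singleton] at h2
  have hne : ∀ k : ℕ, k ≠ j → cols (s.step swaps ⟨T + m, hkN⟩ j).R k = cols s.R k :=
    fun k hk => by rw [h1, Function.update_of_ne hk]
  have hself : cols (s.step swaps ⟨T + m, hkN⟩ j).R j =
      form κ {B + m, B + (m + 1)} (switchVertex b m) (switchPivot m (m + 1)) := by
    rw [h1, Function.update_self, hp]
  have hE' := symmDiff_subset_Ico hE hD
  rw [hED] at hE'
  have htop := h.top.congr (C' := cols (s.step swaps ⟨T + m, hkN⟩ j).R)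
    fun k hk => hne k (by omega)
  obtain ⟨u, hu, rfl⟩ := h.top.exists_of_step (swaps := swaps) (k := ⟨T + m, hkN⟩) (t' := m) (a := switchVertex b m)
    (Q := fun u => u = s.step swaps ⟨T + m, hkN⟩ j) hj (by omega) rfl
    (fun t₁ h1 t₂ h2 => switchPivot_injective (by omega) (by omega)) hE (by omega) (by rw [hC, hp'])
    ⟨_, htop.reduceColumn_self hj hE' (by omega) hself fun t' ht' he => by
      have := switchPivot_injective (by omega) (by omega) he
      omega, rfl⟩
  obtain ⟨v, hv, h3, h4, h5, h6⟩ := htop.exists_processColumn hj hu hE' (by omega) hself (by omega)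
  refine ⟨v, hv, h3, fun t' ht' hor => ?_, fun _ => ?_, fun _ => by omega, fun k hk => ?_,
    fun hb => ?_, fun hb => ?_⟩
  · rw [h4, hne _ (by omega)]
    exact h.orig t' ht' (by omega)
  · rw [h4, ← hj, hself, hp]
  · rcases h5 k with h5 | h5
    · rw [h5, hne _ (by omega)]
      exact h.low k hk
    · exact Or.inr ⟨by omega, h5.2⟩
  · have := h.flips_le hb
    rw [h6, h2]
    split_ifs at this ⊢ <;> omega
  · rw [show m + 2 - (m + 3) = 0 by omega]
    simp

/-- The point where the algorithms diverge: a column with three entries meets one with four, so swap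
exchanges them and twist does not. The resulting sum is the same and walks down the path once, which
is the `3 * m` in `flips_le`. -/
theorem exists_processColumn_second (h : SwitchInv b swaps hm κ B T F (m + 2) s)
    (hκ : κ = B + (2 * m + 3)) (hT : T = κ + (2 * m + 4)) (hj : (j : ℕ) = T + (m + 2)) :
    ∃ u, ProcessColumn swaps j s u ∧ SwitchInv b swaps hm κ B T F (m + 3) u := by
  have hb := switchVertex_bounds b hm
  have hb' := switchVertex_bounds (!b) hm
  have hbb := switchVertex_ne b hm
  have hp : switchPivot m (m + 2) = 1 := by simp [switchPivot]
  have hp' : switchPivot m (m + 1) = 2 * m + 2 := by simp [switchPivot]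
  have hinj : ∀ t₁ < m + 2, ∀ t₂ < m + 2, switchPivot m t₁ = switchPivot m t₂ → t₁ = t₂ :=
    fun t₁ h1 t₂ h2 => switchPivot_injective (by omega) (by omega)
  have hE : {B + (m + 2)} ⊆ Finset.Ico B κ := by
    rw [Finset.singleton_subset_iff, Finset.mem_Ico]
    omega
  have hD : {B + m, B + (m + 1)} ⊆ Finset.Ico B κ := by
    intro x hx
    simp only [Finset.mem_insert, Finset.mem_singleton] at hx
    rw [Finset.mem_Ico]
    omega
  have hDc : ({B + m, B + (m + 1)} : Finset ℕ).card = 2 := card_pair_of_lt (by omega)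
  have hC : cols s.R j = form κ {B + (m + 2)} (switchVertex (!b) m) (2 * m + 2) := by
    rw [hj, h.orig _ (by omega) (by omega)]
    simp [switchGraph]
  have hk := h.before rfl
  have hkN : T + (m + 1) < N := by omega
  have hkj : (⟨T + (m + 1), hkN⟩ : Fin N) < j := Fin.lt_def.2 (by simp; omega)
  have hsum := symmDiff_form (lt_of_subset_Ico hE) (lt_of_subset_Ico hD)
    (a := switchVertex (!b) m) (b := switchVertex b m) (e := 2 * m + 2) (by omega) (by omega) hbb.symm
  obtain ⟨h1, ⟨D', hD', hDc', hDb', hk'⟩, h2⟩ :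
      (∀ k : ℕ, k ≠ T + (m + 1) → cols (s.step swaps ⟨T + (m + 1), hkN⟩ j).R k =
        Function.update (cols s.R) j (form κ (symmDiff {B + (m + 2)} {B + m, B + (m + 1)})
          (switchVertex (!b) m) (switchVertex b m)) k) ∧
      (∃ D ⊆ Finset.Ico B κ, D.card = (if swaps then 1 else 2) ∧
        (∀ x ∈ D, x ≤ B + (m + 2)) ∧
        cols (s.step swaps ⟨T + (m + 1), hkN⟩ j).R (T + (m + 1)) =
        form κ D (if swaps then switchVertex (!b) m else switchVertex b m) (2 * m + 2)) ∧
      (s.step swaps ⟨T + (m + 1), hkN⟩ j).flips ≤ s.flips + 4 := by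
    cases swaps with
    | false =>
      obtain ⟨h1, h2⟩ := step_of_not_swap (swaps := false) (s := s) (j := j)
        (k := ⟨T + (m + 1), hkN⟩) (Or.inl rfl)
      rw [hC, hk, hsum] at h1
      refine ⟨fun k _ => by rw [h1], ⟨_, hD, by simp [hDc], fun x hx => ?_, ?_⟩, ?_⟩
      · simp only [Finset.mem_insert, Finset.mem_singleton] at hx
        omega
      · rw [h1, Function.update_of_ne (by omega), hk]
        simp
      · rw [h2, hk, card_form (lt_of_subset_Ico hD) (by omega), hDc]
    | true =>
      obtain ⟨h1, h2⟩ := step_of_swap (s := s) (j := j) (k := ⟨T + (m + 1), hkN⟩) hkj (by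
        rw [hC, hk, card_form (lt_of_subset_Ico hE) (by omega),
          card_form (lt_of_subset_Ico hD) (by omega), hDc]
        simp)
      rw [hC, hk, hsum] at h1
      refine ⟨fun k hk => ?_, ⟨_, hE, by simp, by simp, ?_⟩, ?_⟩
      · rw [h1]
        rcases eq_or_ne k j with rfl | hkj
        · rw [Function.update_self, Function.update_self]
        · rw [Function.update_of_ne hkj, Function.update_of_ne hk, Function.update_of_ne hkj]
      · rw [h1, Function.update_of_ne (by omega), Function.update_self]
        simp
      · rw [h2, hC, card_form (lt_of_subset_Ico hE) (by omega), Finset.card_singleton]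
        omega
  have hne : ∀ k : ℕ, k ≠ T + (m + 1) → k ≠ j →
      cols (s.step swaps ⟨T + (m + 1), hkN⟩ j).R k = cols s.R k :=
    fun k hk hk' => by rw [h1 k hk, Function.update_of_ne hk']
  -- For either `b` the two switch vertices are `1` and the end `2 * m + 1` of the path.
  have hself : cols (s.step swaps ⟨T + (m + 1), hkN⟩ j).R j =
      form κ (symmDiff {B + (m + 2)} {B + m, B + (m + 1)}) 1 (chainVertex m m) := by
    rw [h1 _ (by omega), Function.update_self, chainVertex_of_pos hm]
    have e : m + 1 + m = 2 * m + 1 := by omega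
    rw [e]
    cases b
    · simp [switchVertex, form_comm]
    · simp [switchVertex]
  have htop : TopInv κ B T (switchPivot m) (m + 2)
      (cols (s.step swaps ⟨T + (m + 1), hkN⟩ j).R) := by
    constructor
    · intro k hk
      rw [hne k (by omega) (by omega)]
      exact h.top.low k hk
    · intro t' ht'
      rcases eq_or_ne t' (m + 1) with rfl | h'
      · rw [hp']
        refine ⟨D', hD', _, ?_, hk'⟩
        split_ifs <;> omega
      · rw [hne _ (by omega) (by omega)]
        exact h.top.processed t' ht'
  have hch := h.chain hκ (x := m + 2) (by omega)
  obtain ⟨u, hu, hcu, ⟨E', hE', hCu⟩, hfu⟩ := h.top.exists_of_step (swaps := swaps)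
    (k := ⟨T + (m + 1), hkN⟩) (t' := m + 1) (a := switchVertex (!b) m) hj (by omega) rfl hinj hE (by omega) (by rw [hC, hp'])
    (exists_reduceColumn_walk (swaps := swaps) (J := {B + (m + 2)}) (y := 1) hj (by omega)
      (fun i hi => by simp [switchPivot, hi]) hinj (by omega) (by omega) (fun t' ht' he => by
        rw [← hp] at he
        have := switchPivot_injective (by omega) (by omega) he
        omega) (w := 3) (by simp) m le_rfl _ _ htop (fun i hi => by
        rw [hne _ (by omega) (by omega)]
        exact hch i hi) (symmDiff_subset_Ico hE hD) (by simp) hself)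
  have htop' := htop.congr (C' := cols u.R) fun k hk => hcu k (by omega)
  obtain ⟨v, hv, h3, h4, h5, h6⟩ := htop'.exists_processColumn (a := 0) hj hu hE' (by omega)
    (by rw [hCu, hp]) (by omega)
  refine ⟨v, hv, h3, fun t' ht' hor => ?_, fun _ => by omega, fun _ => ?_, fun k hk => ?_,
    fun hb => ?_, fun hb => ?_⟩
  · rw [h4, hcu _ (by omega), hne _ (by omega) (by omega)]
    exact h.orig t' ht' (by omega)
  · refine ⟨D', hD', hDc', hDb', ?_⟩
    rw [h4, hcu _ (by omega), hk']
  · rcases h5 k with h5 | h5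
    · rw [h5, hcu _ (by omega), hne _ (by omega) (by omega)]
      exact h.low k hk
    · exact Or.inr ⟨by omega, h5.2⟩
  · have := h.flips_le hb
    rw [h6, hfu]
    split_ifs at this ⊢ <;> omega
  · rw [Nat.sub_self]
    simp

/-- The column kept at position `m + 1` replaces the entry `2 * m + 2` by its own remaining entry
`Y`. For `b = swaps` this is `1`, below `x`, and the column is reduced; otherwise it is the end of
the path, and a full walk follows. -/
theorem exists_processColumn_last (h : SwitchInv b swaps hm κ B T F t s)
    (hκ : κ = B + (2 * m + 3)) (hT : T = κ + (2 * m + 4)) (htm : m + 2 < t) (ht : t < 2 * m + 3)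
    (hj : (j : ℕ) = T + t) :
    ∃ u, ProcessColumn swaps j s u ∧ SwitchInv b swaps hm κ B T F (t + 1) u := by
  have hb := switchVertex_bounds b hm
  have hb' := switchVertex_bounds (!b) hm
  set x := 2 + (t - (m + 3)) with hx
  have hp : switchPivot m t = x := by
    simp only [switchPivot]
    split_ifs <;> omega
  have hp' : switchPivot m (m + 1) = 2 * m + 2 := by simp [switchPivot]
  have hinj : ∀ t₁ < t, ∀ t₂ < t, switchPivot m t₁ = switchPivot m t₂ → t₁ = t₂ :=
    fun t₁ h1 t₂ h2 => switchPivot_injective (by omega) (by omega)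
  have hxp : ∀ t' < t, switchPivot m t' ≠ x := fun t' ht' he => by
    rw [← hp] at he
    have := switchPivot_injective (by omega) (by omega) he
    omega
  have hE : {B + t} ⊆ Finset.Ico B κ := by
    rw [Finset.singleton_subset_iff, Finset.mem_Ico]
    omega
  have hC : cols s.R j = form κ {B + t} x (2 * m + 2) := by
    rw [hj, h.orig _ (by omega) (by omega)]
    have h1 : ¬ t < m := by omega
    have h2 : t ≠ m := by omega
    have h3 : t ≠ m + 1 := by omega
    have h4 : t ≠ m + 2 := by omega
    have h5 : ¬ t ≤ m + 1 := by omega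
    simp [switchGraph, h1, h2, h3, h4, h5, hx]
  obtain ⟨D, hD, hDc, hDb, hk⟩ := h.after htm
  set Y := if swaps then switchVertex (!b) m else switchVertex b m with hY
  have hYp : Y < 2 * m + 2 := by
    rw [hY]
    split_ifs <;> omega
  have hYx : x ≠ Y := by
    have : Y = 1 ∨ Y = 2 * m + 1 := by
      simp only [hY, switchVertex]
      split_ifs <;> simp
    omega
  have hkN : T + (m + 1) < N := by omega
  -- In the swap reduction both columns have three entries, and a tie causes no exchange.
  obtain ⟨h1, h2⟩ := step_of_not_swap (swaps := swaps) (s := s) (j := j)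
    (k := ⟨T + (m + 1), hkN⟩) (by
      rw [hC, hk, card_form (lt_of_subset_Ico hE) (by omega),
        card_form (lt_of_subset_Ico hD) (by omega), hDc]
      cases swaps <;> simp)
  rw [hC, hk, symmDiff_form (lt_of_subset_Ico hE) (lt_of_subset_Ico hD) (by omega) (by omega)
    hYx] at h1
  rw [hk, card_form (lt_of_subset_Ico hD) (by omega)] at h2
  have hDc4 : D.card ≤ 2 := by
    rw [hDc]
    split_ifs <;> omega
  have hne : ∀ k : ℕ, k ≠ j → cols (s.step swaps ⟨T + (m + 1), hkN⟩ j).R k = cols s.R k :=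
    fun k hk => by rw [h1, Function.update_of_ne hk]
  have hself : cols (s.step swaps ⟨T + (m + 1), hkN⟩ j).R j =
      form κ (symmDiff {B + t} D) x Y := by
    rw [h1, Function.update_self]
  have hE' := symmDiff_subset_Ico hE hD
  have htop := h.top.congr (C' := cols (s.step swaps ⟨T + (m + 1), hkN⟩ j).R)
    fun k hk => hne k (by omega)
  obtain ⟨u, hu, hcu, ⟨E₁, hE₁, a, ha, hCu⟩, hfu⟩ := h.top.exists_of_step (swaps := swaps)
    (k := ⟨T + (m + 1), hkN⟩) (t' := m + 1) (a := x)
    (Q := fun u => (∀ k : ℕ, k ≠ j → cols u.R k =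
        cols (s.step swaps ⟨T + (m + 1), hkN⟩ j).R k) ∧
      (∃ E ⊆ Finset.Ico B κ, ∃ a < x, cols u.R j = form κ E a x) ∧
      u.flips = (s.step swaps ⟨T + (m + 1), hkN⟩ j).flips + if b = swaps then 0 else 3 * m)
    hj (by omega) rfl hinj hE (by omega) (by rw [hC, hp']) (by
      by_cases hbs : b = swaps
      · have hY1 : Y = 1 := by
          subst hbs
          cases b <;> simp [hY, switchVertex]
        rw [hY1, form_comm] at hself
        refine ⟨_, htop.reduceColumn_self hj hE' (by omega) hself hxp, fun _ _ => rfl,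
          ⟨_, hE', 1, by omega, hself⟩, by simp [hbs]⟩
      · have hY1 : Y = chainVertex m m := by
          rw [chainVertex_of_pos hm, hY]
          cases b <;> cases swaps <;> simp [switchVertex] at hbs ⊢ <;> omega
        rw [hY1] at hself
        have hch := h.chain hκ (x := t) (by omega)
        obtain ⟨u, hu, hcu, ⟨E', hE', hCu⟩, hfu⟩ :=
          exists_reduceColumn_walk (swaps := swaps) (J := {B + t}) (y := x) hj (by omega)
            (fun i hi => by simp [switchPivot, hi]) hinj (by omega) (by omega) hxp
            (w := 3) (by simp) m le_rfl _ _ htop (fun i hi => by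
            rw [hne _ (by omega)]
            exact hch i hi) hE' (by
              -- The marker `B + t` is not cancelled, because the entries of `D` are at most `B + (m
              -- + 2)`.
              rw [Finset.singleton_subset_iff, Finset.mem_symmDiff]
              refine Or.inl ⟨by simp, fun hmem => ?_⟩
              have := hDb _ hmem
              omega) hself
        exact ⟨u, hu, hcu, ⟨E', hE', 0, by omega, hCu⟩, by rw [hfu, if_neg hbs]⟩)
  have htop' := htop.congr (C' := cols u.R) fun k hk => hcu k (by omega)
  obtain ⟨v, hv, h3, h4, h5, h6⟩ := htop'.exists_processColumn (a := a) hj hu hE₁ (by omega)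
    (by rw [hCu, hp]) (by omega)
  refine ⟨v, hv, h3, fun t' ht' hor => ?_, fun _ => by omega, fun _ => ?_, fun k hk => ?_,
    fun hb => ?_, fun hb => ?_⟩
  · rw [h4, hcu _ (by omega), hne _ (by omega)]
    exact h.orig t' ht' (by omega)
  · refine ⟨D, hD, hDc, hDb, ?_⟩
    rw [h4, hcu _ (by omega), hne _ (by omega), hk]
  · rcases h5 k with h5 | h5
    · rw [h5, hcu _ (by omega), hne _ (by omega)]
      exact h.low k hk
    · exact Or.inr ⟨by omega, h5.2⟩
  · have := h.flips_le hb
    rw [h6, hfu, h2, if_pos hb]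
    split_ifs at this ⊢ <;> omega
  · have := h.le_flips hb
    rw [h6, hfu, if_neg hb, show t + 1 - (m + 3) = t - (m + 3) + 1 by omega, mul_add, h2]
    omega

theorem exists_processColumn (h : SwitchInv b swaps hm κ B T F t s)
    (hκ : κ = B + (2 * m + 3)) (hT : T = κ + (2 * m + 4)) (ht : t < 2 * m + 3)
    (hj : (j : ℕ) = T + t) :
    ∃ u, ProcessColumn swaps j s u ∧ SwitchInv b swaps hm κ B T F (t + 1) u := by
  by_cases h1 : t ≤ m
  · exact h.exists_processColumn_of_le hκ hT h1 hj
  obtain rfl | h2 := eq_or_ne t (m + 1)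
  · exact h.exists_processColumn_first hκ hT hj
  obtain rfl | h3 := eq_or_ne t (m + 2)
  · exact h.exists_processColumn_second hκ hT hj
  · exact h.exists_processColumn_last hκ hT (by omega) ht hj

end SwitchInv

/-! ### Edge and vertex columns of the cone in the twist and swap reductions -/

theorem isGreatest_pair {a b : ℕ} (h : a < b) :
    IsGreatest ((({a, b} : Finset ℕ) : Set ℕ)) b := by
  refine ⟨by simp, fun x hx => ?_⟩
  simp only [Finset.coe_insert, Finset.coe_singleton, Set.mem_insert_iff,
    Set.mem_singleton_iff] at hx
  omega

theorem symmDiff_pair {a b c : ℕ} (hab : a ≠ b) (hcb : c ≠ b) (hac : a ≠ c) :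
    symmDiff ({a, b} : Finset ℕ) {c, b} = {c, a} := by
  ext x
  simp only [Finset.mem_symmDiff, Finset.mem_insert, Finset.mem_singleton]
  omega

namespace EdgeList

variable (G : EdgeList)

theorem coneSimplex_nonstar {i : ℕ} (h : G.baseStart ≤ i) (h' : i < G.triStart) :
    ∃ a b, 0 < a ∧ a < b ∧ b ≤ G.n + 1 ∧ G.coneSimplex i = {a, b} := by
  rcases G.cone_cases (h'.trans_le (Nat.le_add_right _ G.M)) with
    h1 | ⟨v, hv, rfl⟩ | ⟨t, ht, rfl⟩ | ⟨v, hv, rfl⟩ | ⟨t, ht, rfl⟩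
  · unfold baseStart at h
    omega
  · unfold baseStart at h
    omega
  · have := G.lo_lt_hi t ht
    have := G.hi_lt t ht
    exact ⟨_, _, by omega, by omega, by omega, G.coneSimplex_base ht⟩
  · exact ⟨_, _, by omega, by omega, by omega, G.coneSimplex_cone hv⟩
  · omega

/-- The state of the twist and swap reductions before the edge with index `i` is processed. -/
structure EdgeInv (f i : ℕ) (s : State N) : Prop where
  vertex : ∀ k ≤ G.n + 1, cols s.R k = ∅
  star : ∀ v ≤ G.n, cols s.R (G.n + 2 + v) = {0, v + 1}
  edge : ∀ k, G.baseStart ≤ k → k < G.triStart →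
    cols s.R k = ∅ ∨ (i ≤ k ∧ cols s.R k = G.coneSimplex k)
  flips : s.flips ≤ f + 4 * i

variable {G}

/-- The processed base and cone edges have become zero, so only star edges carry pivots. -/
theorem EdgeInv.eq_of_isGreatest {f i : ℕ} {s : State N} (h : G.EdgeInv f i s)
    (hi : i < G.triStart) {k q : ℕ} (hk : k < i) (hq : IsGreatest (cols s.R k : Set ℕ) q) :
    k = G.n + 1 + q ∧ 0 < q := by
  by_cases h1 : k ≤ G.n + 1
  · have := hq.1
    simp [h.vertex k h1] at this
  by_cases h2 : k < G.baseStart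
  · unfold baseStart at h2
    obtain ⟨v, hv, rfl⟩ : ∃ v ≤ G.n, k = G.n + 2 + v := ⟨k - (G.n + 2), by omega, by omega⟩
    rw [h.star v hv] at hq
    have := hq.unique (isGreatest_pair (by omega))
    omega
  · rcases h.edge k (by omega) (by omega) with he | ⟨he, _⟩
    · have := hq.1
      simp [he] at this
    · omega

/-- Star edges have distinct pivots and need no addition. Any other edge `{a, b}` has been cleared,
or vanishes after adding `{0, b}` and `{0, a}`, which costs 4 bitflips. -/
theorem EdgeInv.exists_processColumn {swaps : Bool} {f i : ℕ} {s : State N} {j : Fin N}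
    (h : G.EdgeInv f i s) (hi : i < G.triStart) (hi' : G.n + 2 ≤ i) (hj : (j : ℕ) = i) :
    ∃ u, ProcessColumn swaps j s u ∧ G.EdgeInv f (i + 1) u := by
  by_cases h1 : i < G.baseStart
  · unfold baseStart at h1
    obtain ⟨v, hv, rfl⟩ : ∃ v ≤ G.n, i = G.n + 2 + v := ⟨i - (G.n + 2), by omega, by omega⟩
    have hC := h.star v hv
    have hcl : ∀ k, k ≠ v + 1 → cols (s.clear j).R k = cols s.R k := fun k hk => by
      refine (cols_clear s j k).2 fun hg => hk ?_
      rw [hj, hC] at hg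
      exact hg.unique (isGreatest_pair (by omega))
    have hcl' : cols (s.clear j).R (v + 1) = ∅ := by
      refine (cols_clear s j _).1 ?_
      rw [hj, hC]
      exact isGreatest_pair (by omega)
    refine ⟨s.clear j, ⟨s, .of_pivot fun q hq k hk hkq => ?_, rfl⟩, fun k hk => ?_, fun v' hv' => ?_,
      fun k hk hk' => ?_, ?_⟩
    · have := (h.eq_of_isGreatest hi (hj ▸ hk) hkq).1
      rw [hj, hC] at hq
      have := hq.unique (isGreatest_pair (by omega))
      omega
    · rcases eq_or_ne k (v + 1) with rfl | hne
      · exact hcl'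
      · rw [hcl k hne, h.vertex k hk]
    · rw [hcl _ (by omega), h.star v' hv']
    · have : G.n + 2 + v < k := by
        unfold baseStart at hk
        omega
      rw [hcl _ (by omega)]
      rcases h.edge k hk hk' with he | he
      · exact Or.inl he
      · exact Or.inr ⟨this, he.2⟩
    · have := h.flips
      change s.flips ≤ _
      omega
  · suffices H : ∃ u, ReduceColumn swaps j s u ∧ (∀ k : ℕ, k ≠ j → cols u.R k = cols s.R k) ∧
        cols u.R j = ∅ ∧ u.flips ≤ s.flips + 4 by
      obtain ⟨u, hu, hne, hself, hfl⟩ := H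
      have hcl : ∀ k, cols (u.clear j).R k = cols u.R k := fun k => by
        refine (cols_clear u j k).2 fun hg => ?_
        have := hg.1
        simp [hself] at this
      have hb : 2 * G.n + 3 ≤ i := not_lt.1 h1
      refine ⟨u.clear j, ⟨u, hu, rfl⟩, fun k hk => ?_, fun v' hv' => ?_, fun k hk hk' => ?_, ?_⟩
      · rw [hcl, hne _ (by omega), h.vertex k hk]
      · rw [hcl, hne _ (by omega), h.star v' hv']
      · rw [hcl]
        rcases eq_or_ne k j with rfl | hkj
        · exact Or.inl hself
        · rw [hne k hkj]
          rcases h.edge k hk hk' with he | he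
          · exact Or.inl he
          · exact Or.inr ⟨by omega, he.2⟩
      · have := h.flips
        change u.flips ≤ _
        omega
    rcases h.edge i (by omega) hi with he | ⟨_, he⟩
    · refine ⟨s, .of_pivot fun q hq => ?_, fun _ _ => rfl, by rw [hj, he], by omega⟩
      have := hq.1
      simp [hj, he] at this
    · obtain ⟨a, b, ha, hab, hb, he'⟩ := G.coneSimplex_nonstar (not_lt.1 h1) hi
      rw [he', ← hj] at he
      have hB : 2 * G.n + 3 ≤ i := not_lt.1 h1
      have hstar : ∀ v, 0 < v → v ≤ G.n + 1 → cols s.R (G.n + 1 + v) = {0, v} :=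
        fun v h0 hv => by
          have := h.star (v - 1) (by omega)
          rwa [show G.n + 2 + (v - 1) = G.n + 1 + v by omega, Nat.sub_add_cancel h0] at this
      have hkb : G.n + 1 + b < N := by omega
      have hka : G.n + 1 + a < N := by omega
      have hsb := hstar b (by omega) hb
      have hsa := hstar a ha (by omega)
      have hcard : ∀ {x y : ℕ}, x < y → ({x, y} : Finset ℕ).card = 2 := card_pair_of_lt
      obtain ⟨h3, h4⟩ := step_of_not_swap (swaps := swaps) (s := s) (j := j)
        (k := ⟨G.n + 1 + b, hkb⟩) (Or.inr (by
          rw [hsb, he, hcard hab, hcard (by omega)]))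
      rw [he, hsb, symmDiff_pair (by omega) (by omega) (by omega)] at h3
      rw [hsb, hcard (by omega)] at h4
      set s' := s.step swaps ⟨G.n + 1 + b, hkb⟩ j
      have hne : ∀ k : ℕ, k ≠ j → cols s'.R k = cols s.R k := fun k hk => by
        rw [h3, Function.update_of_ne hk]
      have hs'j : cols s'.R j = {0, a} := by rw [h3, Function.update_self]
      have hs'a : cols s'.R (G.n + 1 + a) = {0, a} := by rw [hne _ (by omega), hsa]
      obtain ⟨h5, h6⟩ := step_of_not_swap (swaps := swaps) (s := s') (j := j)
        (k := ⟨G.n + 1 + a, hka⟩) (Or.inr (by rw [hs'a, hs'j]))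
      rw [hs'j, hs'a, symmDiff_self] at h5
      rw [hs'a, hcard ha] at h6
      refine ReduceColumn.exists_of_step (k := ⟨G.n + 1 + b, hkb⟩) (q := b)
        (Fin.lt_def.2 (by simp; omega)) (by rw [hsb]; exact isGreatest_pair (by omega))
        (by rw [he]; exact isGreatest_pair hab)
        (fun k' hk' hg => (h.eq_of_isGreatest hi (hj ▸ hk') hg).1) ?_
      change ∃ t, ReduceColumn swaps j s' t ∧ _
      refine ReduceColumn.exists_of_step (k := ⟨G.n + 1 + a, hka⟩) (q := a)
        (Fin.lt_def.2 (by simp; omega)) (by rw [hs'a]; exact isGreatest_pair ha)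
        (by rw [hs'j]; exact isGreatest_pair ha)
        (fun k' hk' hg => by
          rw [hne _ (by omega)] at hg
          exact (h.eq_of_isGreatest hi (hj ▸ hk') hg).1) ?_
      refine ⟨_, .of_pivot fun q hq => ?_, fun k hk => ?_, ?_, ?_⟩
      · have := hq.1
        simp [h5] at this
      · rw [h5, Function.update_of_ne hk, hne k hk]
      · rw [h5, Function.update_self]
        rfl
      · omega

theorem EdgeInv.exists_forLoop {swaps : Bool} {f : ℕ} {s : State G.cone.toComplex.size}
    (h : G.EdgeInv f 0 s) : ∃ t, ForLoop (ProcessColumn swaps)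
      ((List.finRange _).filter (fun j => G.cone.toComplex.dim j = 1) ++
        (List.finRange _).filter (fun j => G.cone.toComplex.dim j = 0)) s t ∧
      t.flips ≤ f + 4 * G.cone.size := by
  obtain ⟨t, ht, hinv⟩ := ForLoop.exists_of_invariant (body := ProcessColumn swaps)
    (fun j => G.cone.toComplex.dim j = 1) (fun i s => G.EdgeInv f i s)
    (fun i s hi h => by
      rw [decide_eq_true_eq, dim_cone] at hi
      have h1 : G.n + 2 ≤ i := by
        by_contra hc
        rw [if_pos (by omega)] at hi
        omega
      have h2 : i < G.triStart := by
        by_contra hc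
        rw [if_neg (by omega), if_neg hc] at hi
        omega
      exact h.exists_processColumn h2 h1 rfl)
    (fun i s hi h => by
      rw [decide_eq_false_iff_not, dim_cone] at hi
      refine ⟨h.vertex, h.star, fun k hk hk' => ?_, by have := h.flips; omega⟩
      rcases h.edge k hk hk' with he | ⟨hik, he⟩
      · exact Or.inl he
      · refine Or.inr ⟨?_, he⟩
        rcases eq_or_ne (i : ℕ) k with hik' | hik'
        · rw [hik', if_neg (by unfold baseStart at hk; omega), if_pos hk'] at hi
          exact absurd rfl hi
        · omega) h
  -- Vertex columns are zero, so the last dimension costs nothing.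
  obtain ⟨u, hu, hinv'⟩ := ForLoop.exists_of_invariant (body := ProcessColumn swaps)
    (fun j => G.cone.toComplex.dim j = 0)
    (fun _ u => (∀ k ≤ G.n + 1, cols u.R k = ∅) ∧ u.flips = t.flips)
    (fun i u hi h => by
      rw [decide_eq_true_eq, dim_cone] at hi
      have h1 : (i : ℕ) ≤ G.n + 1 := by
        by_contra hc
        rw [if_neg (by omega)] at hi
        split_ifs at hi
      have hg : ∀ q, ¬ IsGreatest (cols u.R i : Set ℕ) q := fun q hq => by
        have := hq.1
        simp [h.1 i h1] at this
      refine ⟨u.clear i, ⟨u, .of_pivot fun q hq => absurd hq (hg q), rfl⟩, fun k hk => ?_, h.2⟩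
      rw [(cols_clear u i k).2 (hg k), h.1 k hk])
    (fun i u _ h => h) ⟨hinv.vertex, rfl⟩
  refine ⟨u, ht.append hu, ?_⟩
  rw [hinv'.2]
  exact hinv.flips

end EdgeList

/-! ### Total cost of twist and swap on the cones -/

section cone

variable {b : Bool} {m : ℕ} (hm : 0 < m)

theorem cols_switchGraph_tri {t : ℕ} (ht : t < 2 * m + 3) :
    cols (switchGraph b m hm).cone.toComplex.boundaryMatrix ((switchGraph b m hm).triStart + t) =
      form (switchGraph b m hm).coneStart {(switchGraph b m hm).baseStart + t}
        ((switchGraph b m hm).lo t) ((switchGraph b m hm).hi t) := by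
  rw [SimplexList.cols_boundaryMatrix]
  · exact EdgeList.coneFacets_tri _ t
  · exact Nat.add_lt_add_left ht _

theorem exists_forLoop_triangles (swaps : Bool) :
    ∃ s, ForLoop (ProcessColumn swaps)
      ((List.finRange _).filter (fun j => (switchGraph b m hm).cone.toComplex.dim j = 2))
      ⟨(switchGraph b m hm).cone.toComplex.boundaryMatrix, 0⟩ s ∧
      SwitchInv b swaps hm (switchGraph b m hm).coneStart (switchGraph b m hm).baseStart
        (switchGraph b m hm).triStart (switchGraph b m hm).coneFacets (2 * m + 3) s := by
  set G := switchGraph b m hm with hG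
  have hn : G.n = 2 * m + 4 := rfl
  have hM : G.M = 2 * m + 3 := rfl
  have hκ : G.coneStart = G.baseStart + (2 * m + 3) := rfl
  have hT : G.triStart = G.coneStart + (2 * m + 4) := by
    unfold EdgeList.triStart EdgeList.coneStart
    omega
  have hlow : ∀ k < G.triStart, cols G.cone.toComplex.boundaryMatrix k = G.coneFacets k :=
    fun k hk => SimplexList.cols_boundaryMatrix _ (hk.trans_le (Nat.le_add_right _ _))
  obtain ⟨s, hs, hinv⟩ := ForLoop.exists_of_invariant (body := ProcessColumn swaps)
    (fun j => G.cone.toComplex.dim j = 2)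
    (fun i s => SwitchInv b swaps hm G.coneStart G.baseStart G.triStart G.coneFacets
      (i - G.triStart) s)
    (s := ⟨G.cone.toComplex.boundaryMatrix, 0⟩)
    (fun i s hi h => by
      rw [decide_eq_true_eq, EdgeList.dim_cone] at hi
      have h1 : G.triStart ≤ i := by
        by_contra hc
        rw [if_pos (not_le.1 hc)] at hi
        split_ifs at hi
        omega
      have h2 : (i : ℕ) < G.triStart + G.M := i.2
      rw [show (i : ℕ) + 1 - G.triStart = i - G.triStart + 1 by omega]
      exact h.exists_processColumn hκ hT (by omega) (by omega))
    (fun i s hi h => by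
      rw [decide_eq_false_iff_not, EdgeList.dim_cone] at hi
      have h1 : (i : ℕ) < G.triStart := by
        by_contra hc
        rw [if_neg (by unfold EdgeList.triStart at hc; omega), if_neg hc] at hi
        exact hi rfl
      rwa [show (i : ℕ) + 1 - G.triStart = i - G.triStart by omega])
    { top :=
        { low := fun k hk x hx => by
            rw [hlow k hk] at hx
            by_cases h1 : k ≤ G.n + 1
            · simp [G.coneFacets_vertex h1] at hx
            · rw [G.coneFacets_edge (by omega) hk] at hx
              obtain ⟨a, c, hac, hc, he⟩ := G.coneSimplex_edge (by omega) hk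
              rw [he] at hx
              simp only [Finset.mem_insert, Finset.mem_singleton] at hx
              unfold EdgeList.coneStart
              omega
          processed := fun t' ht' => by omega }
      orig := fun t' ht' _ => cols_switchGraph_tri hm ht'
      before := fun h => by omega
      after := fun h => by omega
      low := fun k hk => Or.inl (hlow k hk)
      flips_le := fun _ => Nat.zero_le _
      le_flips := fun _ => by simp }
  refine ⟨s, hs, ?_⟩
  have e : G.cone.toComplex.size - G.triStart = 2 * m + 3 := Nat.add_sub_cancel_left _ _
  rwa [e] at hinv

theorem exists_clearingRun_switchGraph_ge {swaps : Bool} (hb : b ≠ swaps) :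
    ∃ c, ClearingRun swaps (switchGraph b m hm).cone.toComplex c ∧ 3 * m * m ≤ c := by
  obtain ⟨s, hs, hinv⟩ := exists_forLoop_triangles (b := b) hm swaps
  obtain ⟨t, ht, hle⟩ := ForLoop.exists_le (swaps := swaps) _ s
  refine ⟨_, ⟨t, ?_, rfl⟩, le_trans ?_ hle⟩
  · rw [EdgeList.decreasingDimOrder_cone _ (by simp [switchGraph])]
    exact hs.append ht
  · have := hinv.le_flips hb
    rwa [show 2 * m + 3 - (m + 3) = m by omega] at this

theorem exists_clearingRun_switchGraph_le :
    ∃ c, ClearingRun b (switchGraph b m hm).cone.toComplex c ∧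
      c ≤ 8 * (switchGraph b m hm).cone.size := by
  have := exists_forLoop_triangles (b := b) hm b
  set G := switchGraph b m hm with hG
  obtain ⟨s, hs, hinv⟩ := this
  have hn : G.n = 2 * m + 4 := rfl
  have hM : G.M = 2 * m + 3 := rfl
  have hlt : G.n + 1 < G.triStart := by
    unfold EdgeList.triStart
    omega
  obtain ⟨t, ht, hle⟩ := EdgeList.EdgeInv.exists_forLoop (swaps := b) (G := G) (s := s)
    (f := s.flips)
    { vertex := fun k hk => by
        rcases hinv.low k (by omega) with h | h
        · rw [h, G.coneFacets_vertex hk]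
        · exact h.2
      star := fun v hv => by
        have h1 : G.n + 2 + v < G.baseStart := by
          unfold EdgeList.baseStart
          omega
        have h2 : G.n + 2 + v < G.triStart := by
          unfold EdgeList.triStart
          omega
        rcases hinv.low (G.n + 2 + v) h2 with h | h
        · rw [h, G.coneFacets_edge (by omega) h2, G.coneSimplex_star hv]
        · omega
      edge := fun k hk hk' => by
        rcases hinv.low k hk' with h | h
        · rw [h, G.coneFacets_edge (by unfold EdgeList.baseStart at hk; omega) hk']
          exact Or.inr ⟨Nat.zero_le _, rfl⟩
        · exact Or.inl h.2
      flips := by simp }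
  refine ⟨_, ⟨t, ?_, rfl⟩, hle.trans ?_⟩
  · rw [EdgeList.decreasingDimOrder_cone _ (by omega)]
    exact hs.append ht
  -- The triangles cost at most `4 * (2 * m + 3) + 3 * m`, less than four times the size; the other
  -- dimensions contribute at most another four times the size.
  · have := hinv.flips_le rfl
    have e : G.cone.size = 3 * G.n + 3 + G.M + G.M := rfl
    rw [if_pos (by omega)] at this
    omega

end cone

/-! ### Single steps of the retrospective reduction -/

namespace RetroState

theorem pairedEntry_iff {s : RetroState N} {j l k : Fin N} :
    s.PairedEntry j l k ↔ (l : ℕ) ∈ cols s.R j ∧ s.P l = some k ∧ k ≠ j := by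
  rw [PairedEntry, val_mem_cols]

theorem cols_add (s : RetroState N) (k j : Fin N) :
    cols (s.add k j).R = Function.update (cols s.R) j (symmDiff (cols s.R j) (cols s.R k)) :=
  cols_addColumn _ _ _

theorem flips_add (s : RetroState N) (k j : Fin N) :
    (s.add k j).flips = s.flips + (cols s.R k).card := by
  rw [add, colSize_eq]

theorem record_P_eq_some {s : RetroState N} {j l k : Fin N} :
    (s.record j).P l = some k ↔ (IsGreatest (cols s.R j : Set ℕ) l ∧ k = j) ∨
      (¬ IsGreatest (cols s.R j : Set ℕ) l ∧ s.P l = some k) := by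
  simp only [record]
  split_ifs with h <;> rw [pivot_eq_iff] at h
  · simp [h, eq_comm]
  · simp [h]

theorem record_eq_self {s : RetroState N} {j l : Fin N}
    (h : IsGreatest (cols s.R j : Set ℕ) l) (hl : s.P l = some j) : s.record j = s := by
  have : (s.record j).P = s.P := by
    funext i
    simp only [record]
    split_ifs with hi
    · rw [pivot_eq_iff] at hi
      obtain rfl : i = l := Fin.ext (hi.unique h)
      exact hl.symm
    · rfl
  cases s
  simp only [record] at this ⊢
  rw [this]

theorem cols_compress_of_ne (s : RetroState N) (j : Fin N) {k : ℕ} (hk : k ≠ j) :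
    cols (s.compress j).R k = cols s.R k := by
  have : ∀ hk', (⟨k, hk'⟩ : Fin N) ≠ j := fun hk' e => hk (by rw [← e])
  ext i
  simp [mem_cols, compress, this]

/-- Applies to every column that is followed explicitly: edge columns have only vertex rows, and the
negative edges of the cone are the star edges, which are not facets of triangles. -/
theorem cols_compress_eq {s : RetroState N} {j : Fin N}
    (h : ∀ l k, s.P l = some k → (k : ℕ) ∉ cols s.R j) :
    cols (s.compress j).R = cols s.R := by
  funext k
  rcases eq_or_ne k j with rfl | hk
  · refine cols_congr fun i => ?_
    simp only [compress, Matrix.updateCol_self]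
    split_ifs with hi
    · obtain ⟨l, hl⟩ := hi
      have := h l i hl
      rw [val_mem_cols, not_not] at this
      exact this.symm
    · rfl
  · exact cols_compress_of_ne s j hk

end RetroState

/-- When column `k` has no paired entry besides its own pivot, the recursive call merely records its
pair again and leaves the state unchanged. -/
theorem Reduce.of_step {s t : RetroState N} {j l k : Fin N} (hl : (l : ℕ) ∈ cols s.R j)
    (hP : s.P l = some k) (hkj : k ≠ j)
    (hmax : ∀ l' k', s.PairedEntry j l' k' → l' ≤ l)
    (hk : ∀ l' k', ¬ s.PairedEntry k l' k') (hg : IsGreatest (cols s.R k : Set ℕ) l)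
    (h : Reduce j (s.add k j) t) : Reduce j s t := by
  have hr := Reduce.done k s hk
  rw [RetroState.record_eq_self hg hP] at hr
  exact .step j l k s s t (RetroState.pairedEntry_iff.2 ⟨hl, hP, hkj⟩) hmax hr h

/-! ### Termination of the retrospective reduction -/

/-- Every pair consists of a column before `i` and its pivot. -/
def RetroState.PivotPairs (i : ℕ) (s : RetroState N) : Prop :=
  ∀ l k, s.P l = some k → IsGreatest (cols s.R k : Set ℕ) l ∧ (k : ℕ) < i

/-- Strong induction on a bound `b` for the rows of paired entries. If `l` is the largest one,
paired with `k`, then `l` is the pivot of column `k`, so `Reduce(k)` only deals with rows below `l`.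
Afterwards `l` is the sole paired row in column `k`; adding it removes `l` from column `j` and
creates no other paired entry. The clause on untouched columns shows that the recursive call does
not modify column `j`. -/
theorem Reduce.exists_of_lt (i b : ℕ) : ∀ (s : RetroState N) (j : Fin N), s.PivotPairs i →
    (∀ l k, s.PairedEntry j l k → (l : ℕ) < b) →
    ∃ t : RetroState N, Reduce j s (t.record j) ∧ t.P = s.P ∧ t.PivotPairs i ∧
      (∀ l k, ¬ t.PairedEntry j l k) ∧
      (∀ a : Fin N, a ≠ j → (∀ l, s.P l = some a → b ≤ (l : ℕ)) → cols t.R a = cols s.R a) ∧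
      s.flips ≤ t.flips := by
  induction b using Nat.strong_induction_on with
  | _ b ih =>
    intro s j hs hb
    by_cases hex : ∃ l, ∃ k, s.PairedEntry j l k
    · obtain ⟨l, ⟨k, hlk⟩, hmax⟩ := Set.Finite.exists_maximal (Set.toFinite {l | ∃ k, s.PairedEntry j l k}) hex
      have hmax' : ∀ l' k', s.PairedEntry j l' k' → l' ≤ l := fun l' k' h' =>
        not_lt.1 fun hlt => absurd (hmax ⟨k', h'⟩ hlt.le) (not_le.2 hlt)
      have hlb := hb l k hlk
      obtain ⟨hlj, hP, hkj⟩ := RetroState.pairedEntry_iff.1 hlk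
      have hg := (hs l k hP).1
      obtain ⟨u, hu, huP, hui, hun, huc, huf⟩ := ih l hlb s k hs fun l' k' h' => by
        obtain ⟨h1, h2, h3⟩ := RetroState.pairedEntry_iff.1 h'
        refine lt_of_le_of_ne (hg.2 h1) fun e => h3 ?_
        obtain rfl := Fin.ext e
        exact Option.some.inj (h2.symm.trans hP)
      have hug := (hui l k (huP ▸ hP)).1
      rw [RetroState.record_eq_self hug (huP ▸ hP)] at hu
      -- Column `j` may itself be paired; its pivot is then at or above `l`, outside the range of
      -- the recursive call.
      have hjp : ∀ l', s.P l' = some j → (l : ℕ) ≤ l' := fun l' h' => (hs l' j h').1.2 hlj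
      have huj : cols u.R j = cols s.R j := huc j hkj.symm hjp
      have hadd := u.cols_add k j
      have hvi : (u.add k j).PivotPairs i := by
        intro l' k' h'
        have h'' : u.P l' = some k' := h'
        obtain ⟨h1, h2⟩ := hui l' k' h''
        refine ⟨?_, h2⟩
        rw [hadd]
        rcases eq_or_ne k' j with rfl | hne
        · have hll : (l : ℕ) < l' := by
            refine lt_of_le_of_ne (hjp l' (huP ▸ h'')) fun e => hkj ?_
            obtain rfl := Fin.ext e
            exact Option.some.inj (hP.symm.trans (huP ▸ h''))
          rw [Function.update_self]
          constructor
          · rw [Finset.mem_coe, Finset.mem_symmDiff]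
            exact Or.inl ⟨h1.1, fun hc => absurd (hug.2 hc) (by omega)⟩
          · intro x hx
            rw [Finset.mem_coe, Finset.mem_symmDiff] at hx
            rcases hx with hx | hx
            · exact h1.2 hx.1
            · exact (hug.2 hx.1).trans hll.le
        · rwa [Function.update_of_ne fun e => hne (Fin.ext e)]
      obtain ⟨t, ht, htP, hti, htn, htc, htf⟩ := ih l hlb (u.add k j) j hvi fun l' k' h' => by
        obtain ⟨h1, h2, h3⟩ := RetroState.pairedEntry_iff.1 h'
        have h2' : u.P l' = some k' := h2
        rw [hadd, Function.update_self, Finset.mem_symmDiff] at h1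
        rcases h1 with h1 | h1
        · rw [huj] at h1
          refine lt_of_le_of_ne (hmax' l' k' (RetroState.pairedEntry_iff.2
            ⟨h1.1, huP ▸ h2', h3⟩)) fun e => ?_
          rw [e] at h1
          exact h1.2 hug.1
        · have hk' : k' = k := by
            by_contra hne
            exact hun l' k' (RetroState.pairedEntry_iff.2 ⟨h1.1, h2', hne⟩)
          subst hk'
          have : (l' : ℕ) = l := (hui l' k' h2').1.unique hug
          rw [this, huj] at h1
          exact absurd hlj h1.2
      refine ⟨t, .step j l k s u _ hlk hmax' hu ht, htP.trans huP, hti, htn, fun a ha hab => ?_,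
        huf.trans (le_trans (Nat.le_add_right _ _) htf)⟩
      have hak : a ≠ k := by
        rintro rfl
        have := hab l hP
        omega
      have hal : ∀ l', s.P l' = some a → (l : ℕ) ≤ l' := fun l' h' => hlb.le.trans (hab l' h')
      rw [htc a ha (fun l' h' => hal l' (huP ▸ h')), hadd,
        Function.update_of_ne fun e => ha (Fin.ext e), huc a hak hal]
    · have hn : ∀ l k, ¬ s.PairedEntry j l k := fun l k h => hex ⟨l, k, h⟩
      exact ⟨s, .done j s hn, rfl, hs, hn, fun _ _ _ => rfl, le_rfl⟩

/-- Compression alters only column `j`, which is not yet paired, so the pivots of the paired columns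
persist. -/
theorem RetroState.PivotPairs.exists_reduce {s : RetroState N} {j : Fin N} (h : s.PivotPairs j) :
    ∃ t, Reduce j (s.compress j) t ∧ t.PivotPairs (j + 1) ∧ s.flips ≤ t.flips := by
  have h' : (s.compress j).PivotPairs j := fun l k hP => by
    have hP' := h l k hP
    rwa [cols_compress_of_ne s j hP'.2.ne]
  obtain ⟨t, ht, _, hti, _, _, hf⟩ := Reduce.exists_of_lt j N _ j h' fun l _ _ => l.2
  refine ⟨_, ht, fun l k hP => ?_, hf⟩
  rcases record_P_eq_some.1 hP with ⟨h1, rfl⟩ | ⟨_, h2⟩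
  · exact ⟨h1, Nat.lt_succ_self _⟩
  · exact ⟨(hti l k h2).1, (hti l k h2).2.trans (Nat.lt_succ_self _)⟩

theorem Reduce.of_not_pairedEntry {s : RetroState N} {j : Fin N}
    (h : ∀ l k : Fin N, (l : ℕ) ∈ cols s.R j → s.P l = some k → k = j) : Reduce j s (s.record j) :=
  .done j s fun l k hlk => by
    obtain ⟨h1, h2, h3⟩ := RetroState.pairedEntry_iff.1 hlk
    exact h3 (h l k h1 h2)

/-! ### The retrospective reduction of `pathGraph` -/

/-- The state of the retrospective reduction of `pathGraph` before edge `t` is processed. -/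
structure PathRetroInv {m : ℕ} (hm : 0 < m) (t : ℕ) (s : RetroState N) : Prop where
  pairs : ∀ l k, s.P l = some k ↔
    ∃ t' < t, (l : ℕ) = pathPivot m t' ∧ (k : ℕ) = 2 * m + 2 + t'
  vertex : ∀ k < 2 * m + 2, cols s.R k = ∅
  reduced : ∀ t' < t, cols s.R (2 * m + 2 + t') = {0, pathPivot m t'}
  orig : ∀ t', t ≤ t' → t' < 2 * m → cols s.R (2 * m + 2 + t') =
    {(pathGraph m hm).lo t', (pathGraph m hm).hi t'}
  flips : s.flips ≤ 2 * t

theorem pathPivot_bounds {m t : ℕ} (ht : t < 2 * m) :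
    0 < pathPivot m t ∧ pathPivot m t < 2 * m + 2 := by
  simp only [pathPivot, chainVertex_succ]
  split_ifs <;> omega

/-- Every edge of `pathGraph` other than the first one joins its pivot to an earlier pivot. -/
theorem pathGraph_edge {m : ℕ} (hm : 0 < m) {t : ℕ} (h0 : 0 < t) :
    ∃ t' < t, ({(pathGraph m hm).lo t, (pathGraph m hm).hi t} : Finset ℕ) =
      {pathPivot m t, pathPivot m t'} := by
  by_cases h : t < m
  · refine ⟨t - 1, by omega, ?_⟩
    have : t - 1 < m := by omega
    simp only [pathGraph, pathPivot, h, this, if_true, Nat.sub_add_cancel h0]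
    exact Finset.pair_comm _ _
  · refine ⟨m - 1, by omega, ?_⟩
    have : m - 1 < m := by omega
    simp only [pathGraph, pathPivot, h, this, if_true, if_false, Nat.sub_add_cancel hm]

theorem PathRetroInv.exists_reduce_vertex {m : ℕ} {hm : 0 < m} {s : RetroState N} {j : Fin N}
    (h : PathRetroInv hm 0 s) (hj : (j : ℕ) < 2 * m + 2) :
    ∃ u, Reduce j (s.compress j) u ∧ PathRetroInv hm 0 u := by
  have hC := h.vertex j hj
  have hcomp := RetroState.cols_compress_eq (s := s) (j := j) fun l k _ => by simp [hC]
  have hcomp' : cols ((s.compress j).record j).R = cols s.R := hcomp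
  refine ⟨_, Reduce.of_not_pairedEntry fun l k hl => by simp [hcomp, hC] at hl, ?_, ?_, ?_, ?_,
    h.flips⟩
  · intro l k
    rw [RetroState.record_P_eq_some, hcomp, hC]
    have := h.pairs l k
    change (s.compress j).P l = some k ↔ _ at this
    simpa [IsGreatest] using this
  · rw [hcomp']
    exact h.vertex
  · rw [hcomp']
    exact h.reduced
  · rw [hcomp']
    exact h.orig

/-- By `pathGraph_edge` the column is `{pivot t, pivot t'}` with `t' < t`, and the reduced column of
`t'` is `{0, pivot t'}`. One addition of two entries gives `{0, pivot t}`. -/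
theorem PathRetroInv.exists_reduce {m t : ℕ} {hm : 0 < m} {s : RetroState N} {j : Fin N}
    (h : PathRetroInv hm t s) (ht : t < 2 * m) (hj : (j : ℕ) = 2 * m + 2 + t) :
    ∃ u, Reduce j (s.compress j) u ∧ PathRetroInv hm (t + 1) u := by
  have hw := pathPivot_bounds ht
  have hC := h.orig t le_rfl ht
  rw [← hj] at hC
  have hinj : ∀ t' < t, pathPivot m t' ≠ pathPivot m t := fun t' ht' he => by
    have := pathPivot_injective (by omega) ht he
    omega
  have hcomp := RetroState.cols_compress_eq (s := s) (j := j) fun l k hk hmem => by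
    obtain ⟨t', _, _, h2⟩ := (h.pairs l k).1 hk
    have h3 := (pathGraph m hm).lo_lt_hi t ht
    have h4 : (pathGraph m hm).hi t < 2 * m + 2 := (pathGraph m hm).hi_lt t ht
    rw [hC] at hmem
    simp only [Finset.mem_insert, Finset.mem_singleton] at hmem
    omega
  have hself : ∀ u : RetroState N, u.P = s.P → cols u.R j = {0, pathPivot m t} →
      Reduce j u (u.record j) := fun u hP hu => Reduce.of_not_pairedEntry fun l k hl hlk => by
    rw [hP, h.pairs] at hlk
    obtain ⟨t', ht', h1, h2⟩ := hlk
    have := hinj t' ht'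
    have := pathPivot_bounds (m := m) (t := t') (by omega)
    rw [hu] at hl
    simp only [Finset.mem_insert, Finset.mem_singleton] at hl
    omega
  obtain ⟨u, hu, hP, hcu, hfu⟩ : ∃ u : RetroState N, Reduce j (s.compress j) (u.record j) ∧
      u.P = s.P ∧ cols u.R = Function.update (cols s.R) j {0, pathPivot m t} ∧
      u.flips ≤ s.flips + 2 := by
    rcases Nat.eq_zero_or_pos t with rfl | h0
    · have hC' : cols s.R j = {0, pathPivot m 0} := by
        rw [hC]
        simp [pathGraph, pathPivot, hm, chainVertex_zero]
      refine ⟨s.compress j, hself _ rfl (by rw [hcomp, hC']), rfl, ?_, Nat.le_add_right _ _⟩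
      rw [hcomp, ← hC', Function.update_eq_self]
    · obtain ⟨t', ht', he⟩ := pathGraph_edge hm h0
      rw [he] at hC
      have hw' := pathPivot_bounds (m := m) (t := t') (by omega)
      have hne := hinj t' ht'
      have hkN : 2 * m + 2 + t' < N := by omega
      have hlN : pathPivot m t' < N := by omega
      have hred := h.reduced t' ht'
      have hadd := (s.compress j).cols_add ⟨2 * m + 2 + t', hkN⟩ j
      have hfl := (s.compress j).flips_add ⟨2 * m + 2 + t', hkN⟩ j
      rw [hcomp, hC, hred, symmDiff_pair (by omega) (by omega) (by omega)] at hadd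
      rw [hcomp, hred, card_pair_of_lt hw'.1] at hfl
      refine ⟨(s.compress j).add ⟨2 * m + 2 + t', hkN⟩ j, ?_, rfl, hadd, hfl.le⟩
      refine Reduce.of_step (l := ⟨pathPivot m t', hlN⟩) (k := ⟨2 * m + 2 + t', hkN⟩) ?_ ?_ ?_ ?_ ?_
        ?_ (hself _ rfl (by rw [hadd, Function.update_self]))
      · simp [hcomp, hC]
      · exact (h.pairs _ _).2 ⟨t', ht', rfl, rfl⟩
      · rw [ne_eq, Fin.ext_iff, hj]
        simp
        omega
      · intro l' k' h'
        obtain ⟨h1, h2, h3⟩ := RetroState.pairedEntry_iff.1 h'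
        obtain ⟨t₁, ht₁, h4, h5⟩ := (h.pairs l' k').1 h2
        have := hinj t₁ ht₁
        rw [hcomp, hC] at h1
        simp only [Finset.mem_insert, Finset.mem_singleton] at h1
        rw [Fin.le_def]
        simp
        omega
      · intro l' k' h'
        obtain ⟨h1, h2, h3⟩ := RetroState.pairedEntry_iff.1 h'
        obtain ⟨t₁, ht₁, h4, h5⟩ := (h.pairs l' k').1 h2
        rw [hcomp, hred] at h1
        simp only [Finset.mem_insert, Finset.mem_singleton] at h1
        have hw₁ := pathPivot_bounds (m := m) (t := t₁) (by omega)
        refine h3 (Fin.ext ?_)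
        rw [h5, pathPivot_injective (m := m) (t₁ := t₁) (t₂ := t') (by omega) (by omega) (by omega)]
      · rw [hcomp, hred]
        exact isGreatest_pair hw'.1
  refine ⟨_, hu, ?_, ?_, ?_, ?_, ?_⟩
  · intro l k
    have hg : IsGreatest (cols u.R j : Set ℕ) l ↔ (l : ℕ) = pathPivot m t := by
      rw [hcu, Function.update_self]
      exact ⟨fun hg => hg.unique (isGreatest_pair hw.1), fun e => by rw [e]; exact isGreatest_pair hw.1⟩
    rw [RetroState.record_P_eq_some, hg, hP, h.pairs]
    constructor
    · rintro (⟨h1, rfl⟩ | ⟨_, t', ht', h1, h2⟩)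
      · exact ⟨t, by omega, h1, hj⟩
      · exact ⟨t', by omega, h1, h2⟩
    · rintro ⟨t', ht', h1, h2⟩
      rcases Nat.lt_succ_iff_lt_or_eq.1 ht' with h3 | rfl
      · exact Or.inr ⟨h1 ▸ hinj t' h3, t', h3, h1, h2⟩
      · exact Or.inl ⟨h1, Fin.ext (h2.trans hj.symm)⟩
  · intro k hk
    change cols u.R k = ∅
    rw [hcu, Function.update_of_ne (by omega), h.vertex k hk]
  · intro t' ht'
    change cols u.R _ = _
    rw [hcu]
    rcases Nat.lt_succ_iff_lt_or_eq.1 ht' with h3 | rfl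
    · rw [Function.update_of_ne (by omega), h.reduced t' h3]
    · rw [← hj, Function.update_self]
  · intro t' ht' ht''
    change cols u.R _ = _
    rw [hcu, Function.update_of_ne (by omega), h.orig t' (by omega) ht'']
  · have := h.flips
    change u.flips ≤ _
    omega

theorem exists_retroRun_pathGraph {m : ℕ} (hm : 0 < m) :
    ∃ c, RetroRun (pathGraph m hm).graph.toComplex c ∧
      c ≤ 2 * (pathGraph m hm).graph.size := by
  obtain ⟨s, hs, hinv⟩ := ForLoop.exists_of_invariant
    (body := fun j s t => Reduce j (s.compress j) t) (fun _ => true)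
    (fun i s => PathRetroInv hm (i - (2 * m + 2)) s)
    (s := ⟨(pathGraph m hm).graph.toComplex.boundaryMatrix, fun _ => none, 0⟩)
    (fun i s _ h => by
      have hi2 : (i : ℕ) < 2 * m + 2 + 2 * m := i.2
      by_cases hi : (i : ℕ) < 2 * m + 2
      · rw [show (i : ℕ) + 1 - (2 * m + 2) = 0 by omega]
        rw [show (i : ℕ) - (2 * m + 2) = 0 by omega] at h
        exact h.exists_reduce_vertex hi
      · rw [show (i : ℕ) + 1 - (2 * m + 2) = i - (2 * m + 2) + 1 by omega]
        exact h.exists_reduce (by omega) (by omega))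
    (fun i s hi => by simp at hi)
    { pairs := by simp
      vertex := fun k hk => cols_pathGraph_vertex hm hk
      reduced := fun t' ht' => by omega
      orig := fun t' _ ht' => by
        have := cols_pathGraph hm ht'
        simpa [form] using this
      flips := by simp }
  refine ⟨_, ⟨s, by simpa using hs, rfl⟩, hinv.flips.trans ?_⟩
  change 2 * (2 * m + 2 + 2 * m - (2 * m + 2)) ≤ 2 * (2 * m + 2 + 2 * m)
  omega

/-! ### The retrospective reduction of the cone over `switchGraph` -/

/-- The state of the retrospective reduction of the cone over `G` before index `i` is processed,
for `i` at most the index of the first triangle beyond a path. -/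
structure ConeRetroInv (G : EdgeList) (m i : ℕ) (s : RetroState N) : Prop where
  pairs : ∀ l k, s.P l = some k ↔ (k : ℕ) < i ∧
    ((G.n + 2 ≤ k ∧ (k : ℕ) < G.baseStart ∧ (k : ℕ) = G.n + 1 + l) ∨
      (G.triStart ≤ k ∧ (l : ℕ) = G.coneStart + chainVertex m (k - G.triStart + 1)))
  star : ∀ v ≤ G.n, G.n + 2 + v < i → cols s.R (G.n + 2 + v) = {0, v + 1}
  tri : ∀ t, G.triStart + t < i → cols s.R (G.triStart + t) =
    form G.coneStart (Finset.Ico G.baseStart (G.baseStart + t + 1)) 0 (chainVertex m (t + 1))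
  orig : ∀ k < G.triStart + G.M, i ≤ k → cols s.R k = G.coneFacets k
  -- The addition for triangle `t > 0` is counted as `t` bitflips; the sum over the triangles before
  -- `t` is `t * (t - 1) / 2`.
  flips : (i - G.triStart) * (i - G.triStart - 1) ≤ 2 * s.flips

namespace ConeRetroInv

variable {G : EdgeList} {m i : ℕ} {s : RetroState N} {j : Fin N}

theorem pivotPairs (h : ConeRetroInv G m i s) (hm : m ≤ G.M) (hi : i ≤ G.triStart + m) :
    s.PivotPairs i := by
  intro l k hlk
  obtain ⟨hk, h1 | h1⟩ := (h.pairs l k).1 hlk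
  · unfold EdgeList.baseStart at h1
    have := h.star (k - (G.n + 2)) (by omega) (by omega)
    rw [show G.n + 2 + (k - (G.n + 2)) = (k : ℕ) by omega,
      show k - (G.n + 2) + 1 = (l : ℕ) by omega] at this
    rw [this]
    exact ⟨isGreatest_pair (by omega), hk⟩
  · obtain ⟨t, ht⟩ := Nat.exists_eq_add_of_le h1.1
    have := h.tri t (by omega)
    rw [← ht] at this
    rw [this, h1.2, ht, Nat.add_sub_cancel_left]
    refine ⟨isGreatest_form (fun x hx => ?_) (by rw [chainVertex_succ]; omega), by omega⟩
    rw [Finset.mem_Ico] at hx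
    unfold EdgeList.coneStart EdgeList.baseStart at *
    omega

/-- The effect of processing a column on the invariant. -/
theorem record (h : ConeRetroInv G m i s) (hj : (j : ℕ) = i)
    {u : RetroState N} (hP : u.P = s.P) (hne : ∀ k : ℕ, k ≠ j → cols u.R k = cols s.R k)
    (hg : ∀ l : Fin N, IsGreatest (cols u.R j : Set ℕ) l ↔
      (G.n + 2 ≤ i ∧ i < G.baseStart ∧ i = G.n + 1 + l) ∨
      (G.triStart ≤ i ∧ (l : ℕ) = G.coneStart + chainVertex m (i - G.triStart + 1)))
    (hun : ∀ l k, s.P l = some k → ¬ IsGreatest (cols u.R j : Set ℕ) l)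
    (hstar : ∀ v ≤ G.n, i = G.n + 2 + v → cols u.R j = {0, v + 1})
    (htri : ∀ t, i = G.triStart + t → cols u.R j = form G.coneStart
      (Finset.Ico G.baseStart (G.baseStart + t + 1)) 0 (chainVertex m (t + 1)))
    (hf : (i + 1 - G.triStart) * (i + 1 - G.triStart - 1) ≤ 2 * u.flips) :
    ConeRetroInv G m (i + 1) (u.record j) where
  pairs l k := by
    rw [RetroState.record_P_eq_some]
    constructor
    · rintro (⟨h1, rfl⟩ | ⟨_, h2⟩)
      · rw [hj]
        exact ⟨by omega, (hg l).1 h1⟩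
      · rw [hP, h.pairs] at h2
        exact ⟨by omega, h2.2⟩
    · rintro ⟨h1, h2⟩
      rcases Nat.lt_succ_iff_lt_or_eq.1 h1 with h3 | h3
      · have h4 := (h.pairs l k).2 ⟨h3, h2⟩
        exact Or.inr ⟨hun l k h4, hP ▸ h4⟩
      · rw [h3] at h2
        exact Or.inl ⟨(hg l).2 h2, Fin.ext (h3.trans hj.symm)⟩
  star v hv hvi := by
    change cols u.R _ = _
    rcases Nat.lt_succ_iff_lt_or_eq.1 hvi with h3 | h3
    · rw [hne _ (by omega), h.star v hv h3]
    · rw [h3, ← hj]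
      exact hstar v hv h3.symm
  tri t ht := by
    change cols u.R _ = _
    rcases Nat.lt_succ_iff_lt_or_eq.1 ht with h3 | h3
    · rw [hne _ (by omega), h.tri t h3]
    · rw [h3, ← hj]
      exact htri t h3.symm
  orig k hk hik := by
    change cols u.R _ = _
    rw [hne _ (by omega), h.orig k hk (by omega)]
  flips := hf

theorem exists_reduce_vertex (h : ConeRetroInv G m i s) (hj : (j : ℕ) = i) (hi : i ≤ G.n + 1) :
    ∃ u, Reduce j (s.compress j) u ∧ ConeRetroInv G m (i + 1) u := by
  have hlt : G.n + 1 < G.triStart := by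
    unfold EdgeList.triStart
    omega
  have hC := h.orig i (by omega) le_rfl
  rw [G.coneFacets_vertex hi, ← hj] at hC
  have hcomp := RetroState.cols_compress_eq (s := s) (j := j) fun l k _ => by simp [hC]
  have hng : ∀ l, ¬ IsGreatest (cols (s.compress j).R j : Set ℕ) l := fun l hl => by
    have := hl.1
    simp [hcomp, hC] at this
  refine ⟨_, Reduce.of_not_pairedEntry fun l k hl => by simp [hcomp, hC] at hl,
    h.record hj rfl (fun k _ => by rw [hcomp]) (fun l => ?_) (fun l _ _ => hng l)
    (fun v _ hv => by omega) (fun t ht => by omega) ?_⟩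
  · refine ⟨fun hl => absurd hl (hng l), fun hl => ?_⟩
    omega
  · rw [show i + 1 - G.triStart = 0 by omega]
    simp

theorem exists_reduce_star (h : ConeRetroInv G m i s) (hj : (j : ℕ) = i) {v : ℕ} (hv : v ≤ G.n)
    (hi : i = G.n + 2 + v) :
    ∃ u, Reduce j (s.compress j) u ∧ ConeRetroInv G m (i + 1) u := by
  have hlt : 2 * G.n + 3 ≤ G.triStart := by
    unfold EdgeList.triStart
    omega
  have hlt' : G.n + 2 ≤ G.coneStart := by
    unfold EdgeList.coneStart
    omega
  have hB : G.baseStart = 2 * G.n + 3 := rfl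
  have hC := h.orig i (by omega) le_rfl
  rw [G.coneFacets_edge (by omega) (by omega), ← hj, hj, hi, G.coneSimplex_star hv, ← hi, ← hj] at hC
  have hcomp := RetroState.cols_compress_eq (s := s) (j := j) fun l k hk hmem => by
    have := (h.pairs l k).1 hk
    rw [hC] at hmem
    simp only [Finset.mem_insert, Finset.mem_singleton] at hmem
    omega
  have hg : ∀ l : Fin N, IsGreatest (cols (s.compress j).R j : Set ℕ) l ↔ l = v + 1 := fun l => by
    rw [hcomp, hC]
    exact ⟨fun hl => hl.unique (isGreatest_pair (by omega)),
      fun e => by rw [e]; exact isGreatest_pair (by omega)⟩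
  refine ⟨_, Reduce.of_not_pairedEntry fun l k hl hlk => ?_,
    h.record hj rfl (fun k _ => by rw [hcomp]) (fun l => ?_) (fun l k hlk => ?_)
    (fun v' hv' hv => ?_) (fun t ht => by omega) ?_⟩
  · have := (h.pairs l k).1 hlk
    rw [hcomp, hC] at hl
    simp only [Finset.mem_insert, Finset.mem_singleton] at hl
    omega
  · rw [hg]
    omega
  · rw [hg]
    have := (h.pairs l k).1 hlk
    omega
  · rw [hcomp, hC, show v = v' by omega]
  · rw [show i + 1 - G.triStart = 0 by omega]
    simp

/-- Both endpoints are paired with reduced star edges, so two additions give zero and no pair is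
recorded. Thus the edge is positive, and triangle columns keep their entries in this row under
compression. -/
theorem exists_reduce_nonstar (h : ConeRetroInv G m i s) (hj : (j : ℕ) = i)
    (hi : G.baseStart ≤ i) (hi' : i < G.triStart) :
    ∃ u, Reduce j (s.compress j) u ∧ ConeRetroInv G m (i + 1) u := by
  have hlt' : G.n + 2 ≤ G.coneStart := by
    unfold EdgeList.coneStart
    omega
  have hB : G.baseStart = 2 * G.n + 3 := rfl
  obtain ⟨a, b, ha, hab, hb, he⟩ := G.coneSimplex_nonstar hi hi'
  have hC := h.orig i (by omega) le_rfl
  rw [G.coneFacets_edge (by omega) hi', he, ← hj] at hC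
  have hcomp := RetroState.cols_compress_eq (s := s) (j := j) fun l k hk hmem => by
    have := (h.pairs l k).1 hk
    rw [hC] at hmem
    simp only [Finset.mem_insert, Finset.mem_singleton] at hmem
    omega
  have hstar : ∀ v, 0 < v → v ≤ G.n + 1 → cols s.R (G.n + 1 + v) = {0, v} := fun v h0 hv => by
    have := h.star (v - 1) (by omega) (by omega)
    rwa [show G.n + 2 + (v - 1) = G.n + 1 + v by omega, Nat.sub_add_cancel h0] at this
  have hP : ∀ (l k : Fin N), 0 < (l : ℕ) → (l : ℕ) ≤ G.n + 1 → (k : ℕ) = G.n + 1 + l →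
      s.P l = some k := fun l k h0 hl hk => (h.pairs l k).2 ⟨by omega, Or.inl (by omega)⟩
  have hkb : G.n + 1 + b < N := by omega
  have hka : G.n + 1 + a < N := by omega
  have hbN : b < N := by omega
  have haN : a < N := by omega
  have hsb := hstar b (by omega) hb
  have hsa := hstar a ha (by omega)
  have hunp : ∀ (u : RetroState N) (v : ℕ) (hv : G.n + 1 + v < N), u.P = s.P → 0 < v → v ≤ G.n + 1 →
      cols u.R (G.n + 1 + v) = {0, v} →
      ∀ l' k', ¬ u.PairedEntry ⟨G.n + 1 + v, hv⟩ l' k' := fun u v hv hu h0 hvn hcu l' k' h' => by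
    obtain ⟨h1, h2, h3⟩ := RetroState.pairedEntry_iff.1 h'
    rw [hcu] at h1
    rw [hu, h.pairs] at h2
    simp only [Finset.mem_insert, Finset.mem_singleton] at h1
    refine h3 (Fin.ext ?_)
    simp only
    omega
  have hadd := (s.compress j).cols_add ⟨G.n + 1 + b, hkb⟩ j
  rw [hcomp, hC, hsb, symmDiff_pair (by omega) (by omega) (by omega)] at hadd
  set s' := (s.compress j).add ⟨G.n + 1 + b, hkb⟩ j
  have hs'a : cols s'.R (G.n + 1 + a) = {0, a} := by
    rw [hadd, Function.update_of_ne (by omega), hsa]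
  have hs'j : cols s'.R j = {0, a} := by rw [hadd, Function.update_self]
  have hadd' := s'.cols_add ⟨G.n + 1 + a, hka⟩ j
  rw [hs'j, hs'a, symmDiff_self] at hadd'
  set s'' := s'.add ⟨G.n + 1 + a, hka⟩ j
  have hs''j : cols s''.R j = ∅ := by
    rw [hadd', Function.update_self]
    rfl
  have hng : ∀ l, ¬ IsGreatest (cols s''.R j : Set ℕ) l := fun l hl => by
    have := hl.1
    simp [hs''j] at this
  refine ⟨_, ?_, h.record (u := s'') hj rfl (fun k hk => ?_) (fun l => ?_)
    (fun l _ _ => hng l) (fun v hv hv' => by omega) (fun t ht => by omega) ?_⟩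
  · refine Reduce.of_step (l := ⟨b, hbN⟩) (k := ⟨G.n + 1 + b, hkb⟩) ?_
      (hP _ _ (by simp; omega) (by simpa using hb) rfl) (Fin.ne_of_val_ne (by simp; omega))
      (fun l' k' h' => ?_) (hunp _ b hkb rfl (by omega) hb (by rw [hcomp, hsb])) ?_ ?_
    · simp [hcomp, hC]
    · have := (RetroState.pairedEntry_iff.1 h').1
      rw [hcomp, hC] at this
      simp only [Finset.mem_insert, Finset.mem_singleton] at this
      rw [Fin.le_def]
      simp only
      omega
    · rw [hcomp, hsb]
      exact isGreatest_pair (by omega)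
    · change Reduce j s' _
      refine Reduce.of_step (l := ⟨a, haN⟩) (k := ⟨G.n + 1 + a, hka⟩) ?_
        (hP _ _ ha (by simp; omega) rfl) (Fin.ne_of_val_ne (by simp; omega))
        (fun l' k' h' => ?_) (hunp _ a hka rfl ha (by omega) hs'a) ?_ ?_
      · simp [hs'j]
      · have := (RetroState.pairedEntry_iff.1 h').1
        rw [hs'j] at this
        simp only [Finset.mem_insert, Finset.mem_singleton] at this
        rw [Fin.le_def]
        simp only
        omega
      · rw [hs'a]
        exact isGreatest_pair ha
      · exact Reduce.of_not_pairedEntry fun l k hl => by simp [s'', hs''j] at hl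
  · rw [hadd', Function.update_of_ne hk, hadd, Function.update_of_ne hk]
  · refine ⟨fun hl => absurd hl (hng l), fun hl => ?_⟩
    omega
  · rw [show i + 1 - G.triStart = i - G.triStart by omega]
    refine h.flips.trans (Nat.mul_le_mul_left 2 ?_)
    exact (Nat.le_add_right _ _).trans (Nat.le_add_right _ _)

/-- Adding the reduced previous triangle moves the lower top entry to `0` and brings in all earlier
base entries. Base rows are never paired at this stage, so nothing removes them, and the columns
grow by one entry per triangle. -/
theorem exists_reduce_tri (h : ConeRetroInv G m i s) (hj : (j : ℕ) = i) {t : ℕ}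
    (hi : i = G.triStart + t) (htM : t < G.M) (hlo : G.lo t = chainVertex m t)
    (hhi : G.hi t = chainVertex m (t + 1)) :
    ∃ u, Reduce j (s.compress j) u ∧ ConeRetroInv G m (i + 1) u := by
  have hκ : G.coneStart = G.baseStart + G.M := rfl
  have hT : G.triStart = G.coneStart + G.n := by
    unfold EdgeList.triStart EdgeList.coneStart
    omega
  have hB : G.baseStart = 2 * G.n + 3 := rfl
  have hlt := chainVertex_lt_succ m t
  have hhn := G.hi_lt t htM
  have hpos : ∀ x, 0 < chainVertex m (x + 1) := fun x => by
    rw [chainVertex_succ]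
    omega
  have hinj : ∀ x y, chainVertex m (x + 1) = chainVertex m (y + 1) → x = y := fun x y e => by
    rw [chainVertex_succ, chainVertex_succ] at e
    omega
  have hC := h.orig i (by omega) le_rfl
  rw [hi, G.coneFacets_tri, hlo, hhi, ← hi, ← hj] at hC
  replace hC : cols s.R j = form G.coneStart {G.baseStart + t} (chainVertex m t)
    (chainVertex m (t + 1)) := hC
  have hcomp := RetroState.cols_compress_eq (s := s) (j := j) fun l k hk hmem => by
    have := (h.pairs l k).1 hk
    rw [hC, mem_form, Finset.mem_singleton] at hmem
    omega
  have hI : ∀ r < G.M, ∀ x ∈ Finset.Ico G.baseStart (G.baseStart + r + 1), x < G.coneStart :=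
    fun r hr x hx => by
      rw [Finset.mem_Ico] at hx
      omega
  have hself : ∀ u : RetroState N, u.P = s.P →
      cols u.R j = form G.coneStart (Finset.Ico G.baseStart (G.baseStart + t + 1)) 0
        (chainVertex m (t + 1)) → Reduce j u (u.record j) := fun u hP hu =>
    Reduce.of_not_pairedEntry fun l k hl hlk => by
      have h1 := (h.pairs l k).1 (hP ▸ hlk)
      have h2 := hpos (k - G.triStart)
      have h3 := hinj (k - G.triStart) t
      rw [hu, mem_form, Finset.mem_Ico] at hl
      omega
  obtain ⟨u, hu, hP, hcu, hfu⟩ : ∃ u : RetroState N, Reduce j (s.compress j) (u.record j) ∧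
      u.P = s.P ∧ cols u.R = Function.update (cols s.R) j
        (form G.coneStart (Finset.Ico G.baseStart (G.baseStart + t + 1)) 0
          (chainVertex m (t + 1))) ∧ s.flips + t ≤ u.flips := by
    rcases Nat.eq_zero_or_pos t with rfl | h0
    · have hC' : cols s.R j = form G.coneStart (Finset.Ico G.baseStart (G.baseStart + 0 + 1)) 0
          (chainVertex m (0 + 1)) := by
        rw [hC, chainVertex_zero]
        simp
      refine ⟨s.compress j, hself _ rfl (by rw [hcomp, hC']), rfl, ?_, le_rfl⟩
      rw [hcomp, ← hC', Function.update_eq_self]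
    · obtain ⟨r, rfl⟩ : ∃ r, t = r + 1 := ⟨t - 1, by omega⟩
      have hkN : G.triStart + r < N := by omega
      have hlN : G.coneStart + chainVertex m (r + 1) < N := by omega
      have hred := h.tri r (by omega)
      have hpr := hpos r
      have hadd := (s.compress j).cols_add ⟨G.triStart + r, hkN⟩ j
      have hfl := (s.compress j).flips_add ⟨G.triStart + r, hkN⟩ j
      rw [hcomp, hC, hred, form_comm _ {_}, symmDiff_form (fun x hx => by
        rw [Finset.mem_singleton] at hx
        omega) (hI r (by omega)) hlt.ne' hpr.ne (hpos _).ne', form_comm] at hadd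
      have hE : symmDiff {G.baseStart + (r + 1)}
          (Finset.Ico G.baseStart (G.baseStart + r + 1)) =
          Finset.Ico G.baseStart (G.baseStart + (r + 1) + 1) := by
        ext x
        simp only [Finset.mem_symmDiff, Finset.mem_singleton, Finset.mem_Ico]
        omega
      rw [hE] at hadd
      rw [hcomp, hred, card_form (hI r (by omega)) hpr.ne, Nat.card_Ico] at hfl
      refine ⟨(s.compress j).add ⟨G.triStart + r, hkN⟩ j, ?_, rfl, hadd, ?_⟩
      · refine Reduce.of_step (l := ⟨G.coneStart + chainVertex m (r + 1), hlN⟩)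
          (k := ⟨G.triStart + r, hkN⟩) ?_ ?_ (Fin.ne_of_val_ne (by simp; omega)) ?_ ?_ ?_
          (hself _ rfl (by rw [hadd, Function.update_self]))
        · simp [hcomp, hC, mem_form]
        · refine (h.pairs _ _).2 ⟨by simp; omega, Or.inr ⟨by simp, ?_⟩⟩
          simp
        · intro l' k' h'
          obtain ⟨h1, h2, h3⟩ := RetroState.pairedEntry_iff.1 h'
          have h4 := (h.pairs l' k').1 h2
          have h5 := hinj (k' - G.triStart) (r + 1)
          rw [hcomp, hC, mem_form, Finset.mem_singleton] at h1
          rw [Fin.le_def]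
          simp only
          omega
        · intro l' k' h'
          obtain ⟨h1, h2, h3⟩ := RetroState.pairedEntry_iff.1 h'
          have h4 := (h.pairs l' k').1 h2
          have h5 := hinj (k' - G.triStart) r
          have h6 := hpos (k' - G.triStart)
          rw [hcomp, hred, mem_form, Finset.mem_Ico] at h1
          refine h3 (Fin.ext ?_)
          simp only
          omega
        · rw [hcomp, hred]
          exact isGreatest_form (hI r (by omega)) hpr
      · rw [hfl]
        change s.flips + (r + 1) ≤ s.flips + _
        omega
  have hg : ∀ l : Fin N, IsGreatest (cols u.R j : Set ℕ) l ↔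
      l = G.coneStart + chainVertex m (t + 1) := fun l => by
    rw [hcu, Function.update_self]
    have := isGreatest_form (hI t htM) (hpos t)
    exact ⟨fun hl => hl.unique this, fun e => by rwa [e]⟩
  refine ⟨_, hu, h.record hj hP (fun k hk => ?_) (fun l => ?_) (fun l k hlk hl => ?_)
    (fun v hv hv' => by omega) (fun t' ht' => ?_) ?_⟩
  · rw [hcu, Function.update_of_ne hk]
  · rw [hg, hi, Nat.add_sub_cancel_left]
    omega
  · rw [hg] at hl
    have h1 := (h.pairs l k).1 hlk
    have h2 := hinj (k - G.triStart) t
    omega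
  · obtain rfl : t = t' := by omega
    rw [hcu, Function.update_self]
  · have := h.flips
    rw [hi, Nat.add_sub_cancel_left] at this
    rw [hi, show G.triStart + t + 1 - G.triStart = t + 1 by omega, Nat.add_sub_cancel]
    rcases Nat.eq_zero_or_pos t with rfl | h0
    · simp
    · obtain ⟨r, rfl⟩ : ∃ r, t = r + 1 := ⟨t - 1, by omega⟩
      rw [Nat.add_sub_cancel] at this
      nlinarith

end ConeRetroInv

theorem exists_retroRun_switchGraph (b : Bool) {m : ℕ} (hm : 0 < m) :
    ∃ c, RetroRun (switchGraph b m hm).cone.toComplex c ∧ m * (m - 1) ≤ 2 * c := by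
  set G := switchGraph b m hm with hG
  have hM : G.M = 2 * m + 3 := rfl
  have hB : G.baseStart = 2 * G.n + 3 := rfl
  have hT : G.baseStart ≤ G.triStart := by
    unfold EdgeList.triStart
    omega
  obtain ⟨s, hs, hinv⟩ := ForLoop.exists_of_invariant
    (body := fun j s t => Reduce j (s.compress j) t) (fun _ => true)
    -- The exact state is followed only through the `m` path triangles, which already give the
    -- quadratic bound. From there on, termination and a counter that does not decrease are enough.
    (fun i s => (i ≤ G.triStart + m → ConeRetroInv G m i s) ∧
      (G.triStart + m ≤ i → s.PivotPairs i ∧ m * (m - 1) ≤ 2 * s.flips))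
    (s := ⟨G.cone.toComplex.boundaryMatrix, fun _ => none, 0⟩)
    (fun i s _ h => by
      have hi : (i : ℕ) < G.triStart + G.M := i.2
      by_cases him : (i : ℕ) < G.triStart + m
      · have h' := h.1 him.le
        suffices H : ∃ u, Reduce i (s.compress i) u ∧ ConeRetroInv G m (i + 1) u by
          obtain ⟨u, hu, hinv⟩ := H
          refine ⟨u, hu, fun _ => hinv, fun hle => ⟨hinv.pivotPairs (by omega) (by omega), ?_⟩⟩
          have := hinv.flips
          rwa [show (i : ℕ) + 1 - G.triStart = m by omega] at this
        by_cases h1 : (i : ℕ) ≤ G.n + 1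
        · exact h'.exists_reduce_vertex rfl h1
        by_cases h2 : (i : ℕ) < G.baseStart
        · exact h'.exists_reduce_star rfl (v := i - (G.n + 2)) (by omega) (by omega)
        by_cases h3 : (i : ℕ) < G.triStart
        · exact h'.exists_reduce_nonstar rfl (by omega) h3
        · have htm : (i : ℕ) - G.triStart < m := by omega
          exact h'.exists_reduce_tri rfl (t := i - G.triStart) (by omega) (by omega)
            (if_pos htm) (if_pos htm)
      · obtain ⟨h1, h2⟩ := h.2 (by omega)
        obtain ⟨u, hu, hp, hf⟩ := h1.exists_reduce
        exact ⟨u, hu, fun _ => by omega, fun _ => ⟨hp, by omega⟩⟩)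
    (fun i s hi => by simp at hi)
    ⟨fun _ =>
      { pairs := by simp
        star := fun _ _ h => by omega
        tri := fun _ h => by omega
        orig := fun k hk _ => SimplexList.cols_boundaryMatrix _ hk
        flips := by simp }, fun h => by omega⟩
  refine ⟨_, ⟨s, by simpa using hs, rfl⟩, (hinv.2 ?_).2⟩
  change _ ≤ G.triStart + G.M
  omega

/-! ### Sizes, constants and the three families -/

theorem size_switchGraph (b : Bool) {m : ℕ} (hm : 0 < m) :
    (switchGraph b m hm).cone.toComplex.size = 10 * m + 21 := by
  change 3 * (2 * m + 4) + 3 + (2 * m + 3) + (2 * m + 3) = _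
  ring

theorem size_pathGraph {m : ℕ} (hm : 0 < m) :
    (pathGraph m hm).graph.toComplex.size = 4 * m + 2 := by
  change 2 * m + 2 + 2 * m = _
  ring

/-- A complex on which `A` uses linearly many bitflips and the other algorithms quadratically
many. -/
def Separates (A : Algorithm) (K : FilteredComplex ℕ) : Prop :=
  ∀ B, ∃ b, Bitflips B K b ∧ (B = A → b ≤ 8 * K.size) ∧ (B ≠ A → K.size ^ 2 ≤ 2000 * b)

theorem separates_pathGraph {m : ℕ} (hm : 1 < m) :
    Separates .retrospective (pathGraph m (by omega)).graph.toComplex := by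
  have h0 : 0 < m := by omega
  have hsize := size_pathGraph h0
  have key : ∀ swaps, ∃ b, ClearingRun swaps (pathGraph m h0).graph.toComplex b ∧
      (4 * m + 2) ^ 2 ≤ 2000 * b := fun swaps => by
    obtain ⟨c, hc, hle⟩ := exists_clearingRun_pathGraph swaps h0
    exact ⟨c, hc, by nlinarith⟩
  rintro (_ | _ | _)
  · obtain ⟨c, hc, hle⟩ := key false
    exact ⟨c, hc, by simp, fun _ => by rwa [hsize]⟩
  · obtain ⟨c, hc, hle⟩ := key true
    exact ⟨c, hc, by simp, fun _ => by rwa [hsize]⟩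
  · obtain ⟨c, hc, hle⟩ := exists_retroRun_pathGraph h0
    exact ⟨c, hc, fun _ => hle.trans (Nat.mul_le_mul_right _ (by omega)), by simp⟩

theorem separates_switchGraph (b : Bool) {m : ℕ} (hm : 1 < m) :
    Separates (if b then .swap else .twist) (switchGraph b m (by omega)).cone.toComplex := by
  have h0 : 0 < m := by omega
  have hsize := size_switchGraph b h0
  obtain ⟨c₁, hc₁, hle₁⟩ := exists_clearingRun_switchGraph_le (b := b) h0
  obtain ⟨c₂, hc₂, hle₂⟩ := exists_clearingRun_switchGraph_ge (b := b) (swaps := !b) h0 (by simp)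
  obtain ⟨c₃, hc₃, hle₃⟩ := exists_retroRun_switchGraph b h0
  have h₂ : (10 * m + 21) ^ 2 ≤ 2000 * c₂ := by nlinarith
  -- The constant 2000 is dictated by `m = 2`, where the bound only gives `c₃ ≥ 1` and the size is
  -- 41, with square 1681.
  have h₃ : (10 * m + 21) ^ 2 ≤ 2000 * c₃ := by
    obtain ⟨r, rfl⟩ : ∃ r, m = r + 2 := ⟨m - 2, by omega⟩
    rw [show r + 2 - 1 = r + 1 by omega] at hle₃
    nlinarith
  rintro (_ | _ | _)
  · cases b
    · exact ⟨c₁, hc₁, fun _ => hle₁, by simp⟩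
    · exact ⟨c₂, hc₂, by simp, fun _ => by rwa [hsize]⟩
  · cases b
    · exact ⟨c₂, hc₂, by simp, fun _ => by rwa [hsize]⟩
    · exact ⟨c₁, hc₁, fun _ => hle₁, by simp⟩
  · exact ⟨c₃, hc₃, by cases b <;> simp, fun _ => by rwa [hsize]⟩

theorem exists_strictMono_separates (A : Algorithm) : ∃ K : ℕ → FilteredComplex ℕ,
    StrictMono (fun m => (K m).size) ∧ ∀ m, Separates A (K m) := by
  have key : ∀ b : Bool, ∃ K : ℕ → FilteredComplex ℕ, StrictMono (fun m => (K m).size) ∧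
      ∀ m, Separates (if b then .swap else .twist) (K m) := fun b => by
    -- The shift by 2 keeps the lower bound `m * (m - 1)` positive.
    refine ⟨fun m => (switchGraph b (m + 2) (by omega)).cone.toComplex, fun i j hij => ?_,
      fun m => separates_switchGraph b (by omega)⟩
    simp only [size_switchGraph]
    omega
  cases A
  · exact key false
  · exact key true
  · refine ⟨fun m => (pathGraph (m + 2) (by omega)).graph.toComplex, fun i j hij => ?_,
      fun m => separates_pathGraph (by omega)⟩
    simp only [size_pathGraph]
    omega

end MatrixReduction

theorem mainTheorem3 (A : MatrixReduction.Algorithm) :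
    ∃ (K : ℕ → FilteredComplex ℕ) (bitflips : MatrixReduction.Algorithm → ℕ → ℕ),
      StrictMono (fun m => (K m).size) ∧
      (∀ B m, MatrixReduction.Bitflips B (K m) (bitflips B m)) ∧
      (fun m => (bitflips A m : ℝ)) =O[Filter.atTop] (fun m => ((K m).size : ℝ)) ∧
      ∀ B, B ≠ A →
        (fun m => ((K m).size : ℝ) ^ 2) =O[Filter.atTop] (fun m => (bitflips B m : ℝ)) := by
  obtain ⟨K, hK, hsep⟩ := MatrixReduction.exists_strictMono_separates A
  choose f hf hle hge using hsep
  refine ⟨K, fun B m => f m B, hK, fun B m => hf m B, ?_, fun B hB => ?_⟩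
  · refine Asymptotics.IsBigO.of_bound 8 (Filter.Eventually.of_forall fun m => ?_)
    rw [Real.norm_of_nonneg (Nat.cast_nonneg _), Real.norm_of_nonneg (Nat.cast_nonneg _)]
    exact_mod_cast hle m A rfl
  · refine Asymptotics.IsBigO.of_bound 2000 (Filter.Eventually.of_forall fun m => ?_)
    rw [Real.norm_of_nonneg (by positivity), Real.norm_of_nonneg (Nat.cast_nonneg _)]
    exact_mod_cast hge m B hB
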